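/- Let $\Gamma$ be a discrete subgroup of $\mathrm{SL}_2(\mathbb C)$, acting through $\mathrm{PSL}_2(\mathbb C)=\mathrm{Isom}_+(\mathbb H^3)$ on the upper half-space $\mathbb H^3=\{(z,t): z\in\mathbb C,\ t>0\}$ and on $\partial\mathbb H^3=\mathbb C\cup\{\infty\}$. Assume that $\Gamma$ is non-elementary (its limit set $\Lambda$ has at least three points) and geometrically finite (every point of $\Lambda$ is a conical limit point or a bounded parabolic point), and let $M=\mathbb H^3/\Gamma$. Assume that $\infty$ is fixed by a parabolic element of $\Gamma$, let $e$ be the corresponding cusp of $M$ and $\Gamma_\infty$ the stabilizer of $\infty$ in $\Gamma$. Normalize $\Gamma$ so that the boundary of the maximal cusp neighborhood of $e$ is covered by the horosphere $\{t=1\}$: for every $h>0$, the horosphere $\{t=h\}$ is disjoint from all its images $\gamma\{t=h\}$, $\gamma\in\Gamma\setminus\Gamma_\infty$, if and only if $h>1$. A geodesic line of $M$ starting from $e$ is the image of the vertical line from $\infty$ to a point $p\in\mathbb C$, where $p$ is taken modulo $\Gamma_\infty$. It is rational if $p\in\Gamma\infty$, and irrational if $p$ is a conical limit point that is not fixed by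 a parabolic element of $\Gamma$ (that is, if the line is recurrent in some compact subset of $M$ and converges to no cusp). Let $d$ be the quotient of the Euclidean distance on $\mathbb C/\Gamma_\infty$. The depth $D(r)$ of a rational line $r$, with lift from $\infty$ to $\gamma\infty$, is $\ell_\eta-2\eta$ for any $\eta>0$, where $\ell_\eta$ is the hyperbolic length of the segment of this lift between $\{t=e^\eta\}$ and $\gamma\{t=e^\eta\}$. The Hurwitz constant $K(\xi)$ of an irrational line $\xi$ is the infimum of the $K>0$ such that $d(\xi,r)\le K e^{-D(r)}$ for infinitely many rational lines $r$, and the Hurwitz constant $K_{M,e}$ of the cusp is the supremum of $K(\xi)$ over all irrational lines $\xi$ starting from $e$. For $\gamma\in\Gamma$ with lower left entry $c(\gamma)\neq0$, set $$ht(\gamma)=\left|\frac{\sqrt{\mathrm{tr}^2\gamma-4}}{2c(\gamma)}\right| .$$ If $\gamma\in\Gamma$ is loxodromic (its complex translation length has positive real part), then $c(\gamma)\ne 0$ and $ht(\gamma)$ is the Euclidean height $t$ of the highest point of the translation axis of $\gamma$; moreover $\delta\mapsto ht(\delta\gamma\delta^{-1})$ attains its maximum on $\Gamma$. Finally, as an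 equality in $[0,\infty]$ (with $1/0=\infty$ and $1/\infty=0$), $$\frac{1}{2K_{M,e}}=\inf_{\gamma\in\Gamma\ \text{loxodromic}}\ \max_{\delta\in\Gamma}\ ht(\delta\gamma\delta^{-1}).$$ -/

import Mathlib

open scoped MatrixGroups ENNReal

noncomputable section

/-- Hyperbolic `3`-space, in the upper half-space model `{(z, t) | z ∈ ℂ, t > 0}`. -/
@[ext]
structure H3 where
  /-- the horizontal coordinate -/
  z : ℂ
  /-- the vertical coordinate -/
  t : ℝ
  t_pos : 0 < t

namespace H3

/-- The hyperbolic distance of the metric `(|dz|² + dt²) / t²`. -/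
def hdist (x y : H3) : ℝ :=
  2 * Real.arsinh (√(‖x.z - y.z‖ ^ 2 + (x.t - y.t) ^ 2) / (2 * √(x.t * y.t)))

/-- The point `(0, s)` with `s > 0`. -/
def onAxis (s : ℝ) (hs : 0 < s) : H3 := ⟨0, s, hs⟩

/-- The base point `(0, 1)`. -/
def base : H3 := onAxis 1 one_pos

/-- The denominator `|cz + d|² + |c|² t²` of the action of `SL(2, ℂ)`. -/
def denom (g : SL(2, ℂ)) (x : H3) : ℝ :=
  Complex.normSq (g 1 0 * x.z + g 1 1) + Complex.normSq (g 1 0) * x.t ^ 2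

theorem denom_pos (g : SL(2, ℂ)) (x : H3) : 0 < denom g x := by
  have h1 := Complex.normSq_nonneg (g 1 0 * x.z + g 1 1)
  have ht : 0 < x.t ^ 2 := pow_pos x.t_pos 2
  unfold denom
  by_cases hc : g 1 0 = 0
  · have hd : g 1 1 ≠ 0 := by
      intro hd
      have := g.det_coe
      rw [Matrix.det_fin_two, hc, hd] at this
      simp at this
    have : 0 < Complex.normSq (g 1 1) := Complex.normSq_pos.2 hd
    simpa [hc] using this
  · have : 0 < Complex.normSq (g 1 0) := Complex.normSq_pos.2 hc
    positivity

/-- The action of `SL(2, ℂ)` on hyperbolic `3`-space by orientation preserving isometries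
(the Poincaré extension of the action by Möbius transformations). -/
instance : SMul SL(2, ℂ) H3 where
  smul g x :=
    { z := ((g 0 0 * x.z + g 0 1) * star (g 1 0 * x.z + g 1 1) + g 0 0 * star (g 1 0) * x.t ^ 2)
        / (denom g x : ℂ)
      t := x.t / denom g x
      t_pos := div_pos x.t_pos (denom_pos g x) }

/-- The inclusion of hyperbolic space in its compactification; the latter is seen inside
the one-point compactification of `ℂ × ℝ`. -/
def toCompactification (x : H3) : OnePoint (ℂ × ℝ) := ((x.z, x.t) : ℂ × ℝ)

end H3

/-- The inclusion of the boundary at infinity `ℂ ∪ {∞}` of hyperbolic `3`-space in the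
one-point compactification of `ℂ × ℝ`. -/
def boundaryToCompactification : OnePoint ℂ → OnePoint (ℂ × ℝ) :=
  OnePoint.map fun p : ℂ => (p, (0 : ℝ))

/-- The action of `SL(2, ℂ)` on `ℂ ∪ {∞}` by Möbius transformations. -/
instance : MulAction SL(2, ℂ) (OnePoint ℂ) :=
  MulAction.compHom (OnePoint ℂ) (Matrix.SpecialLinearGroup.toGL (n := Fin 2) (R := ℂ))

section Kleinian

variable (Γ : Subgroup SL(2, ℂ))

/-- The limit set: the accumulation in the boundary at infinity of the orbit of a point. -/
def limitSet : Set (OnePoint ℂ) :=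
  {ξ | boundaryToCompactification ξ ∈
    closure {y | ∃ γ ∈ Γ, y = (γ • H3.base).toCompactification}}

/-- Conical limit points: endpoints of a geodesic ray whose image in `ℍ³ / Γ` is recurrent in
some compact subset. Every unit speed geodesic line is `s ↦ g • (0, exp s)` for some
`g ∈ SL(2, ℂ)`, and its positive endpoint is `g • ∞`. Relatively compact means bounded. -/
def IsConicalLimitPoint (ξ : OnePoint ℂ) : Prop :=
  ξ ∈ limitSet Γ ∧ ∃ g : SL(2, ℂ), g • (OnePoint.infty : OnePoint ℂ) = ξ ∧ ∃ R : ℝ,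
    ∃ᶠ s : ℝ in Filter.atTop, ∃ γ ∈ Γ,
      H3.hdist (γ • g • H3.onAxis (Real.exp s) (Real.exp_pos s)) H3.base ≤ R

/-- Fixed points of parabolic elements of `Γ`. -/
def IsParabolicFixedPoint (ξ : OnePoint ℂ) : Prop :=
  ∃ γ ∈ Γ, (γ : Matrix (Fin 2) (Fin 2) ℂ).IsParabolic ∧ γ • ξ = ξ

/-- Bounded parabolic points: limit points `ξ` fixed by a parabolic element, such that the
stabilizer of `ξ` acts cocompactly on the complement of `ξ` in the limit set. -/
def IsBoundedParabolicPoint (ξ : OnePoint ℂ) : Prop :=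
  ξ ∈ limitSet Γ ∧ IsParabolicFixedPoint Γ ξ ∧
    ∃ C : Set (OnePoint ℂ), IsCompact C ∧ C ⊆ limitSet Γ \ {ξ} ∧
      ∀ η ∈ limitSet Γ \ {ξ}, ∃ γ ∈ Γ, γ • ξ = ξ ∧ γ • η ∈ C

/-- Geometrical finiteness: every limit point is conical or bounded parabolic. -/
def IsGeometricallyFinite : Prop :=
  ∀ ξ ∈ limitSet Γ, IsConicalLimitPoint Γ ξ ∨ IsBoundedParabolicPoint Γ ξ

/-- A group is non elementary if its limit set has at least three points. -/
def IsNonElementary : Prop := 3 ≤ (limitSet Γ).encard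

/-- The horizontal horosphere `t = h`, centered at `∞`. -/
def horosphere (h : ℝ) : Set H3 := {x | x.t = h}

/-- The normalization of `Γ` at the cusp `∞`: the quotient of the horosphere `t = h` by the
stabilizer of `∞` embeds in `ℍ³ / Γ` exactly when `h > 1`, i.e. the boundary of the maximal
Margulis neighborhood of the cusp is covered by the horosphere `t = 1`. -/
def IsCuspNormalized : Prop :=
  ∀ h : ℝ, 0 < h →
    ((∀ γ ∈ Γ, γ • (OnePoint.infty : OnePoint ℂ) ≠ OnePoint.infty →
        Disjoint ((fun x => γ • x) '' horosphere h) (horosphere h)) ↔ 1 < h)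

/-- Two points of `ℂ` are identified if they differ by an element of the stabilizer of `∞`. -/
def linkSetoid : Setoid ℂ where
  r p q := ∃ δ ∈ Γ, δ • (OnePoint.infty : OnePoint ℂ) = OnePoint.infty ∧ δ • (p : OnePoint ℂ) = q
  iseqv :=
    { refl := fun p => ⟨1, Γ.one_mem, one_smul _ _, one_smul _ _⟩
      symm := by
        rintro p q ⟨δ, hδ, h1, h2⟩
        exact ⟨δ⁻¹, Γ.inv_mem hδ, by rw [inv_smul_eq_iff, h1], by rw [inv_smul_eq_iff, h2]⟩
      trans := by
        rintro p q r ⟨δ, hδ, h1, h2⟩ ⟨ε, hε, h3, h4⟩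
        exact ⟨ε * δ, Γ.mul_mem hε hδ, by rw [mul_smul, h1, h3], by rw [mul_smul, h2, h4]⟩ }

/-- The geodesic lines of `ℍ³ / Γ` starting from the cusp `∞`: the vertical line from `∞` to
`p ∈ ℂ`, up to the stabilizer of `∞` in `Γ`. -/
def CuspLine : Type := Quotient (linkSetoid Γ)

variable {Γ}

/-- `p ∈ ℂ` is the endpoint of a lift starting at `∞` of the line `ξ`. -/
def CuspLine.HasEndpoint (ξ : CuspLine Γ) (p : ℂ) : Prop := Quotient.mk (linkSetoid Γ) p = ξ

/-- Rational lines: those that converge to the cusp from which they start. -/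
def CuspLine.IsRational (ξ : CuspLine Γ) : Prop :=
  ∃ p : ℂ, ξ.HasEndpoint p ∧ ∃ γ ∈ Γ, γ • (OnePoint.infty : OnePoint ℂ) = p

/-- Irrational lines: those that are recurrent in some compact subset of `ℍ³ / Γ` and do not
converge to any cusp. -/
def CuspLine.IsIrrational (ξ : CuspLine Γ) : Prop :=
  ∃ p : ℂ, ξ.HasEndpoint p ∧ IsConicalLimitPoint Γ p ∧ ¬ IsParabolicFixedPoint Γ p

/-- The distance on the link of the cusp: the quotient of the Euclidean distance of `ℂ`
(equivalently, of the flat metric of the horosphere `t = 1`). -/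
def CuspLine.ldist (ξ η : CuspLine Γ) : ℝ :=
  sInf {r | ∃ p q : ℂ, ξ.HasEndpoint p ∧ η.HasEndpoint q ∧ r = dist p q}

/-- The depth of a rational line: for a lift from `∞` to `p = γ • ∞`, the length of its segment
between the horosphere `t = exp 1` (at height `1` above the boundary `t = 1` of the maximal
Margulis neighborhood) and the image of that horosphere under `γ`, minus `2`. The set below is
a singleton if the line is rational. -/
def CuspLine.depth (ξ : CuspLine Γ) : ℝ :=
  sInf {D | ∃ p : ℂ, ξ.HasEndpoint p ∧ ∃ γ ∈ Γ, γ • (OnePoint.infty : OnePoint ℂ) = p ∧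
    ∃ x ∈ horosphere (Real.exp 1), ∃ y ∈ (fun x => γ • x) '' horosphere (Real.exp 1),
      x.z = p ∧ y.z = p ∧ D = H3.hdist x y - 2}

/-- The Hurwitz constant of a line `ξ` starting from the cusp: the infimum of the `K > 0` such
that `d(ξ, r) ≤ K exp (-D(r))` for infinitely many rational lines `r`. -/
def CuspLine.hurwitzConstant (ξ : CuspLine Γ) : ℝ≥0∞ :=
  ⨅ (K : ℝ) (_ : 0 < K ∧
    {r : CuspLine Γ | r.IsRational ∧ ξ.ldist r ≤ K * Real.exp (-r.depth)}.Infinite),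
    ENNReal.ofReal K

variable (Γ)

/-- The Hurwitz constant of the cusp `∞` of `ℍ³ / Γ`: the supremum of the Hurwitz constants of
the irrational lines starting from the cusp. -/
def cuspHurwitzConstant : ℝ≥0∞ :=
  ⨆ (ξ : CuspLine Γ) (_ : ξ.IsIrrational), ξ.hurwitzConstant

end Kleinian

/-- `g` conjugates `γ` to the Möbius transformation `z ↦ exp ℓ * z`. -/
def ConjugatesToScrew (g γ : SL(2, ℂ)) (ℓ : ℂ) : Prop :=
  ((g * γ * g⁻¹ : SL(2, ℂ)) : Matrix (Fin 2) (Fin 2) ℂ) =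
    !![Complex.exp (ℓ / 2), 0; 0, Complex.exp (-ℓ / 2)]

/-- Loxodromic elements: those with a complex translation length of positive real part. -/
def IsLoxodromic (γ : SL(2, ℂ)) : Prop :=
  ∃ (g : SL(2, ℂ)) (ℓ : ℂ), 0 < ℓ.re ∧ ConjugatesToScrew g γ ℓ

/-- The translation axis of a loxodromic element: the geodesic line mapped to the vertical line
above `0` by the elements conjugating `γ` to a multiplication `z ↦ exp ℓ * z`. -/
def loxodromicAxis (γ : SL(2, ℂ)) : Set H3 :=
  {x | ∃ (g : SL(2, ℂ)) (ℓ : ℂ), 0 < ℓ.re ∧ ConjugatesToScrew g γ ℓ ∧ (g • x).z = 0}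

/-- The height `|√(tr² γ - 4) / (2 c(γ))|` of `γ`, where `c(γ)` is the lower left entry. -/
def height (γ : SL(2, ℂ)) : ℝ :=
  √ ‖(γ : Matrix (Fin 2) (Fin 2) ℂ).trace ^ 2 - 4‖ / (2 * ‖γ 1 0‖)

end

/-!
A bottom row `(c, d)` of an element `δ` of `Γ` records the horoball centered at `δ⁻¹ ∞ = -d / c`, and
everything is expressed by such rows. Let `k` map the vertical line above `0` to a geodesic line, and
let `(c', d')` be the bottom row of `δ k`. The highest point of the image by `δ` of this line
has height `1 / (2 |c' d'|)`.

* For the axis of a loxodromic element `σ = k diag(u, u⁻¹) k⁻¹`, this is `height (δ σ δ⁻¹)`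
  (`height_conj_diag`, `conj_conj_diag`). Replacing `δ` by `δ σ ^ n`, the point of the axis that
  is highest from the viewpoint of `δ` may be taken in a fundamental segment (`exists_balanced`).
  Then `(c, d)` is bounded if the height is bounded below, hence takes finitely many values up to sign
  (`finite_bottomSq`), and the maximum over `δ` is attained.
* For the vertical line from `∞` to `ξ`, it is `1 / (2 |c| |c ξ + d|)`. The depth of the rational line
  with endpoint `p = -d / c` is `2 log |c|` (`CuspLine.depth_eq`), so that `p` approximates `ξ` with
  the constant `K` exactly if this height is at least `1 / (2 K)`. Therefore `1 / (2 K(ξ))` is the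
  upper limit of the heights of the translates of this vertical line, and the formula compares the
  infimum of these upper limits with an infimum over closed geodesics.

If `ξ` is the attracting fixed point of a loxodromic element, the vertical line is asymptotic to its
axis and the upper limit is at most the height of the axis (`finite_approximants_of_le`). This gives
one inequality, `le_iSup_height`.

Conversely let `ξ` be irrational. As `ξ` is a conical limit point, the vertical line above `ξ` returns
infinitely often to a bounded region of the quotient, so two of its tangent frames, far up the line
and far from each other, are almost equivalent under `Γ` (`exists_close_pair`). The element of `Γ` that
carries one near the other is loxodromic, and its axis follows the vertical line along a
fundamental segment (`exists_eigenframe`). By `exists_balanced` the heights of this axis are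
almost bounded by the heights of the part of the vertical line near `ξ`, that is, by the upper limit;
here one uses that `ξ` is not a parabolic fixed point, so that each horoball is visible only from a
bounded part of the line (`exists_loxodromic_of_finite_approximants`). This gives the other
inequality, `iInf_iSup_height_le`.
-/

/-! ### Matrices of `SL(2, ℂ)` -/

namespace SL2C

theorem det_eq (g : SL(2, ℂ)) : g 0 0 * g 1 1 - g 0 1 * g 1 0 = 1 := by
  rw [← Matrix.det_fin_two]
  exact g.det_coe

theorem mul_apply (g h : SL(2, ℂ)) (i j : Fin 2) :
    (g * h) i j = g i 0 * h 0 j + g i 1 * h 1 j := by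
  rw [Matrix.SpecialLinearGroup.coe_mul, Matrix.mul_apply, Fin.sum_univ_two]

theorem inv_apply_zero_zero (g : SL(2, ℂ)) : g⁻¹ 0 0 = g 1 1 := by
  simp [Matrix.adjugate_fin_two]

theorem inv_apply_zero_one (g : SL(2, ℂ)) : g⁻¹ 0 1 = -g 0 1 := by
  simp [Matrix.adjugate_fin_two]

theorem inv_apply_one_zero (g : SL(2, ℂ)) : g⁻¹ 1 0 = -g 1 0 := by
  simp [Matrix.adjugate_fin_two]

theorem inv_apply_one_one (g : SL(2, ℂ)) : g⁻¹ 1 1 = g 0 0 := by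
  simp [Matrix.adjugate_fin_two]

theorem ext_entries {g h : SL(2, ℂ)} (h00 : g 0 0 = h 0 0) (h01 : g 0 1 = h 0 1)
    (h10 : g 1 0 = h 1 0) (h11 : g 1 1 = h 1 1) : g = h := by
  ext i j
  fin_cases i <;> fin_cases j <;> assumption

/-- The diagonal matrix with entries `u` and `u⁻¹`. -/
noncomputable def diag : ℂˣ →* SL(2, ℂ) where
  toFun u := ⟨!![(u : ℂ), 0; 0, ((u⁻¹ : ℂˣ) : ℂ)], by simp [Matrix.det_fin_two]⟩
  map_one' := by
    ext i j
    fin_cases i <;> fin_cases j <;> simp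
  map_mul' u v := by
    refine Subtype.ext ?_
    change !![((u * v : ℂˣ) : ℂ), 0; 0, (((u * v)⁻¹ : ℂˣ) : ℂ)] =
      !![(u : ℂ), 0; 0, ((u⁻¹ : ℂˣ) : ℂ)] * !![(v : ℂ), 0; 0, ((v⁻¹ : ℂˣ) : ℂ)]
    rw [Matrix.mul_fin_two]
    simp [mul_comm]

@[simp] theorem diag_zero_zero (u : ℂˣ) : diag u 0 0 = (u : ℂ) := rfl
@[simp] theorem diag_zero_one (u : ℂˣ) : diag u 0 1 = 0 := rfl
@[simp] theorem diag_one_zero (u : ℂˣ) : diag u 1 0 = 0 := rfl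
@[simp] theorem diag_one_one (u : ℂˣ) : diag u 1 1 = ((u⁻¹ : ℂˣ) : ℂ) := rfl

theorem mul_diag_apply_zero (g : SL(2, ℂ)) (u : ℂˣ) (i : Fin 2) :
    (g * diag u) i 0 = g i 0 * u := by
  rw [mul_apply, diag_zero_zero, diag_one_zero, mul_zero, add_zero]

theorem mul_diag_apply_one (g : SL(2, ℂ)) (u : ℂˣ) (i : Fin 2) :
    (g * diag u) i 1 = g i 1 * (u : ℂ)⁻¹ := by
  rw [mul_apply, diag_zero_one, diag_one_one, mul_zero, zero_add, Units.val_inv_eq_inv_val]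

theorem bottom_row_ne_zero (g : SL(2, ℂ)) (h : g 1 0 = 0) : g 1 1 ≠ 0 := by
  intro h'
  have := det_eq g
  simp [h, h'] at this

end SL2C

open SL2C

/-! ### The action on hyperbolic space -/

namespace H3

theorem smul_t (g : SL(2, ℂ)) (x : H3) : (g • x).t = x.t / denom g x := rfl

theorem smul_z (g : SL(2, ℂ)) (x : H3) :
    (g • x).z = ((g 0 0 * x.z + g 0 1) * star (g 1 0 * x.z + g 1 1)
      + g 0 0 * star (g 1 0) * x.t ^ 2) / (denom g x : ℂ) := rfl

theorem coe_denom (g : SL(2, ℂ)) (x : H3) :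
    (denom g x : ℂ) = (g 1 0 * x.z + g 1 1) * star (g 1 0 * x.z + g 1 1)
      + g 1 0 * star (g 1 0) * x.t ^ 2 := by
  simp only [denom]
  push_cast
  rw [← Complex.mul_conj, ← Complex.mul_conj]
  rfl

/-- The positive definite Hermitian matrix of determinant `1` that represents a point of
hyperbolic space; `SL(2, ℂ)` acts on these by congruence. -/
noncomputable def herm (x : H3) : Matrix (Fin 2) (Fin 2) ℂ :=
  !![(x.z * star x.z + x.t ^ 2) / x.t, x.z / x.t; star x.z / x.t, 1 / x.t]

theorem herm_injective : Function.Injective herm := by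
  intro x y h
  have hx : (x.t : ℂ) ≠ 0 := by exact_mod_cast x.t_pos.ne'
  have hy : (y.t : ℂ) ≠ 0 := by exact_mod_cast y.t_pos.ne'
  have h1 : (1 : ℂ) / x.t = 1 / y.t := congrFun (congrFun h 1) 1
  have h2 : x.z / x.t = y.z / y.t := congrFun (congrFun h 0) 1
  have ht : (x.t : ℂ) = y.t := by
    rw [one_div, one_div] at h1
    exact inv_injective h1
  rw [ht] at h2
  exact H3.ext ((div_left_inj' hy).1 h2) (by exact_mod_cast ht)

theorem herm_smul (g : SL(2, ℂ)) (x : H3) :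
    herm (g • x) = (g : Matrix (Fin 2) (Fin 2) ℂ) * herm x
      * (g : Matrix (Fin 2) (Fin 2) ℂ).conjTranspose := by
  have hx : (x.t : ℂ) ≠ 0 := by exact_mod_cast x.t_pos.ne'
  have hd : (denom g x : ℂ) ≠ 0 := by exact_mod_cast (denom_pos g x).ne'
  have hD := H3.coe_denom g x
  have hdet := det_eq g
  have hdet' : star (g 0 0) * star (g 1 1) - star (g 0 1) * star (g 1 0) = 1 := by
    rw [← star_mul', ← star_mul', ← star_sub, hdet, star_one]
  have ht : ((g • x).t : ℂ) = x.t / denom g x := by rw [smul_t]; push_cast; rfl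
  have hst : star ((denom g x : ℝ) : ℂ) = denom g x := Complex.conj_ofReal _
  have hst' : star ((x.t : ℝ) : ℂ) = x.t := Complex.conj_ofReal _
  ext i j
  fin_cases i <;> fin_cases j <;>
    simp only [herm, Matrix.mul_apply, Fin.sum_univ_two, Matrix.conjTranspose_apply,
      Matrix.of_apply, Matrix.cons_val', Matrix.cons_val_zero, Matrix.cons_val_one,
      Matrix.cons_val_fin_one, Fin.zero_eta, Fin.mk_one, Fin.isValue]
  · rw [ht, smul_z]
    simp only [star_div₀, star_add, star_mul', star_star, star_pow, hst, hst']
    field_simp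
    rw [hD]
    simp only [star_add, star_mul']
    set Z := star x.z
    set a := g 0 0
    set b := g 0 1
    set c := g 1 0
    set d := g 1 1
    linear_combination -(x.t : ℂ) ^ 2 * ((a * d - b * c) * hdet' + hdet)
  · rw [ht, smul_z]
    field_simp
    simp only [star_add, star_mul']
    ring
  · rw [ht, smul_z]
    simp only [star_div₀, star_add, star_mul', star_star, star_pow, hst, hst']
    field_simp
    ring
  · rw [ht]
    field_simp
    rw [hD]
    simp only [star_add, star_mul']
    ring

theorem mul_smul' (g h : SL(2, ℂ)) (x : H3) : (g * h) • x = g • h • x := by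
  apply herm_injective
  simp only [herm_smul, Matrix.SpecialLinearGroup.coe_mul, Matrix.conjTranspose_mul,
    Matrix.mul_assoc]

theorem one_smul' (x : H3) : (1 : SL(2, ℂ)) • x = x := by
  apply herm_injective
  simp [herm_smul]

theorem inv_smul_smul' (g : SL(2, ℂ)) (x : H3) : g⁻¹ • g • x = x := by
  rw [← mul_smul', inv_mul_cancel, one_smul']

theorem smul_inv_smul' (g : SL(2, ℂ)) (x : H3) : g • g⁻¹ • x = x := by
  rw [← mul_smul', mul_inv_cancel, one_smul']

theorem denom_onAxis (g : SL(2, ℂ)) (s : ℝ) (hs : 0 < s) :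
    denom g (onAxis s hs) = ‖g 1 0‖ ^ 2 * s ^ 2 + ‖g 1 1‖ ^ 2 := by
  simp [denom, onAxis, Complex.normSq_eq_norm_sq, add_comm]

theorem diag_smul_onAxis (u : ℂˣ) (s : ℝ) (hs : 0 < s) :
    diag u • onAxis s hs = onAxis (‖(u : ℂ)‖ ^ 2 * s)
      (mul_pos (pow_pos (norm_pos_iff.2 u.ne_zero) 2) hs) := by
  have hu : ‖(u : ℂ)‖ ≠ 0 := norm_ne_zero_iff.2 u.ne_zero
  ext1
  · simp [smul_z, onAxis]
  · rw [smul_t, denom_onAxis]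
    simp only [onAxis, diag_one_zero, diag_one_one, Units.val_inv_eq_inv_val, norm_inv, norm_zero]
    field_simp
    ring

/-- The Frobenius norm of a matrix is controlled by the displacement of the base point. -/
theorem sum_norm_sq_le (g : SL(2, ℂ)) (R : ℝ) (h : hdist (g • base) base ≤ R) :
    ‖g 0 0‖ ^ 2 + ‖g 0 1‖ ^ 2 + ‖g 1 0‖ ^ 2 + ‖g 1 1‖ ^ 2 ≤ 4 * Real.sinh (R / 2) ^ 2 + 2 := by
  set x := g • base with hx
  have hpos := x.t_pos
  have hH := herm_smul g base
  have h11 := congrFun (congrFun hH 1) 1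
  have h00 := congrFun (congrFun hH 0) 0
  simp only [herm, base, onAxis, Matrix.mul_apply, Fin.sum_univ_two, Matrix.conjTranspose_apply,
      Matrix.of_apply, Matrix.cons_val', Matrix.cons_val_zero, Matrix.cons_val_one,
      Matrix.cons_val_fin_one, Fin.isValue] at h11 h00
  simp only [star_zero, mul_zero, Complex.ofReal_one, one_pow, zero_add, div_one,
    mul_one, add_zero, Complex.star_def, Complex.mul_conj, Complex.normSq_eq_norm_sq] at h11 h00
  have e11 : 1 / x.t = ‖g 1 0‖ ^ 2 + ‖g 1 1‖ ^ 2 := by exact_mod_cast h11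
  have e00 : (‖x.z‖ ^ 2 + x.t ^ 2) / x.t = ‖g 0 0‖ ^ 2 + ‖g 0 1‖ ^ 2 := by exact_mod_cast h00
  have hb : base.t = 1 := rfl
  have hbz : base.z = 0 := rfl
  have h1 : √(‖x.z‖ ^ 2 + (x.t - 1) ^ 2) / (2 * √x.t) ≤ Real.sinh (R / 2) := by
    rw [← Real.arsinh_le_arsinh, Real.arsinh_sinh]
    have : hdist x base = 2 * Real.arsinh (√(‖x.z‖ ^ 2 + (x.t - 1) ^ 2) / (2 * √x.t)) := by
      simp [hdist, hb, hbz]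
    linarith
  have h2 : (‖x.z‖ ^ 2 + (x.t - 1) ^ 2) / (4 * x.t) ≤ Real.sinh (R / 2) ^ 2 := by
    have := pow_le_pow_left₀ (by positivity) h1 2
    rw [div_pow, mul_pow, Real.sq_sqrt (by positivity), Real.sq_sqrt hpos.le] at this
    norm_num at this
    exact this
  have h3 : (‖x.z‖ ^ 2 + x.t ^ 2) / x.t + 1 / x.t
      = 4 * ((‖x.z‖ ^ 2 + (x.t - 1) ^ 2) / (4 * x.t)) + 2 := by
    field_simp
    ring
  linarith

end H3

/-! ### The action on the boundary -/

theorem smul_infty_eq (g : SL(2, ℂ)) :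
    g • (OnePoint.infty : OnePoint ℂ) = if g 1 0 = 0 then OnePoint.infty else
      ((g 0 0 / g 1 0 : ℂ) : OnePoint ℂ) := by
  change Matrix.SpecialLinearGroup.toGL g • (OnePoint.infty : OnePoint ℂ) = _
  rw [OnePoint.smul_infty_eq_ite]
  split_ifs with h1 h2 h2
  · rfl
  · exact absurd h1 h2
  · exact absurd h2 h1
  · rfl

theorem smul_infty_eq_infty_iff (g : SL(2, ℂ)) :
    g • (OnePoint.infty : OnePoint ℂ) = OnePoint.infty ↔ g 1 0 = 0 := by
  rw [smul_infty_eq]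
  split_ifs with h <;> simp [h]

theorem smul_infty_eq_coe_iff (g : SL(2, ℂ)) (p : ℂ) :
    g • (OnePoint.infty : OnePoint ℂ) = (p : OnePoint ℂ) ↔ g 1 0 ≠ 0 ∧ g 0 0 = p * g 1 0 := by
  rw [smul_infty_eq]
  split_ifs with h
  · simp [h]
  · rw [OnePoint.coe_eq_coe, div_eq_iff h]
    simp [h]

/-- The action of the stabilizer of `∞` on `ℂ`. -/
theorem smul_coe_of_apply_one_zero (g : SL(2, ℂ)) (h : g 1 0 = 0) (p : ℂ) :
    g • (p : OnePoint ℂ) = ((g 0 0 * (g 0 0 * p + g 0 1) : ℂ) : OnePoint ℂ) := by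
  have hdet := det_eq g
  rw [h, mul_zero, sub_zero] at hdet
  have hd : g 1 1 ≠ 0 := bottom_row_ne_zero g h
  change Matrix.SpecialLinearGroup.toGL g • (p : OnePoint ℂ) = _
  rw [OnePoint.smul_some_eq_ite]
  have h' : (Matrix.SpecialLinearGroup.toGL g) 1 0 = 0 := h
  have hd' : (Matrix.SpecialLinearGroup.toGL g) 1 1 ≠ 0 := hd
  rw [h', zero_mul, zero_add, if_neg hd', OnePoint.coe_eq_coe]
  change (g 0 0 * p + g 0 1) / g 1 1 = _
  rw [div_eq_iff hd]
  linear_combination (-(g 0 0 * p + g 0 1)) * hdet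

/-! ### Discreteness -/

theorem isCompact_setOf_norm_le (R : ℝ) : IsCompact {g : SL(2, ℂ) | ∀ i j, ‖g i j‖ ≤ R} := by
  have h : IsCompact {A : Matrix (Fin 2) (Fin 2) ℂ | ∀ i, A i ∈
      {v : Fin 2 → ℂ | ∀ j, v j ∈ Metric.closedBall (0 : ℂ) R}} :=
    isCompact_pi_infinite fun i => isCompact_pi_infinite fun j => isCompact_closedBall 0 R
  have h' := Matrix.SpecialLinearGroup.isClosedEmbedding_val.isCompact_preimage h
  simp only [Metric.mem_closedBall, dist_zero_right, Set.preimage_ofPred_eq,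
    Set.mem_ofPred_eq] at h'
  exact h'

theorem exists_parabolic_apply {Γ : Subgroup SL(2, ℂ)}
    (hcusp : IsParabolicFixedPoint Γ (OnePoint.infty : OnePoint ℂ)) :
    ∃ T ∈ Γ, T 1 0 = 0 ∧ T 0 0 = T 1 1 ∧ T 0 1 ≠ 0 := by
  obtain ⟨T, hT, hpar, hfix⟩ := hcusp
  have h10 := (smul_infty_eq_infty_iff T).1 hfix
  have := (Matrix.isParabolic_iff_of_upperTriangular h10).1 hpar
  exact ⟨T, hT, h10, this.1, this.2⟩

section Discrete

variable {Γ : Subgroup SL(2, ℂ)} [DiscreteTopology Γ]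

theorem finite_inter_of_isCompact {K : Set SL(2, ℂ)} (hK : IsCompact K) :
    {γ : SL(2, ℂ) | γ ∈ Γ ∧ γ ∈ K}.Finite := by
  have h := Γ.tendsto_coe_cofinite_of_discrete (isDiscrete_iff_discreteTopology.2 inferInstance)
  have h1 : {γ : Γ | (γ : SL(2, ℂ)) ∈ K}.Finite := by
    have := h hK.compl_mem_cocompact
    rw [Filter.mem_map, Filter.mem_cofinite] at this
    convert this using 1
    ext γ
    simp
  refine (h1.image (fun γ : Γ => (γ : SL(2, ℂ)))).subset ?_
  rintro γ ⟨h1, h2⟩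
  exact ⟨⟨γ, h1⟩, h2, rfl⟩

/-- The quadratic monomials in the entries of the bottom row of a matrix. -/
noncomputable def bottomSq (δ : SL(2, ℂ)) : ℂ × ℂ × ℂ := (δ 1 0 ^ 2, δ 1 0 * δ 1 1, δ 1 1 ^ 2)

/-- Up to signs, a bounded region of `ℂ × ℂ` contains only finitely many bottom rows of
elements of `Γ`: the conjugate of a parabolic element fixing `∞` by `δ⁻¹` depends only on
the bottom row of `δ`, and quadratically so. -/
theorem finite_bottomSq (hcusp : IsParabolicFixedPoint Γ (OnePoint.infty : OnePoint ℂ)) (R : ℝ) :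
    (bottomSq '' {δ : SL(2, ℂ) | δ ∈ Γ ∧ ‖δ 1 0‖ ≤ R ∧ ‖δ 1 1‖ ≤ R}).Finite := by
  obtain ⟨T, hT, h10, h00, h01⟩ := exists_parabolic_apply hcusp
  set a := T 1 1
  set b := T 0 1
  refine ((finite_inter_of_isCompact (Γ := Γ)
    (isCompact_setOf_norm_le (‖a‖ + ‖b‖ * (R * R)))).image
    (fun m : SL(2, ℂ) => (-m 1 0 / b, (m 0 0 - a) / b, m 0 1 / b))).subset ?_
  rintro _ ⟨δ, ⟨hδ, hc, hd⟩, rfl⟩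
  have hdet := det_eq δ
  have hR : 0 ≤ R := (norm_nonneg _).trans hc
  have e00 : (δ⁻¹ * T * δ) 0 0 = a + b * (δ 1 0 * δ 1 1) := by
    simp only [mul_apply, inv_apply_zero_zero, inv_apply_zero_one, h10, h00]
    linear_combination a * hdet
  have e01 : (δ⁻¹ * T * δ) 0 1 = b * (δ 1 1 * δ 1 1) := by
    simp only [mul_apply, inv_apply_zero_zero, inv_apply_zero_one, h10, h00]
    ring
  have e10 : (δ⁻¹ * T * δ) 1 0 = - (b * (δ 1 0 * δ 1 0)) := by
    simp only [mul_apply, inv_apply_one_zero, inv_apply_one_one, h10, h00]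
    ring
  have e11 : (δ⁻¹ * T * δ) 1 1 = a - b * (δ 1 0 * δ 1 1) := by
    simp only [mul_apply, inv_apply_one_zero, inv_apply_one_one, h10, h00]
    linear_combination a * hdet
  have bound : ∀ x y : ℂ, ‖x‖ ≤ R → ‖y‖ ≤ R → ‖b * (x * y)‖ ≤ ‖b‖ * (R * R) := by
    intro x y hx hy
    rw [norm_mul, norm_mul]
    gcongr
  refine ⟨δ⁻¹ * T * δ, ⟨Γ.mul_mem (Γ.mul_mem (Γ.inv_mem hδ) hT) hδ, ?_⟩, ?_⟩
  · intro i j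
    fin_cases i <;> fin_cases j <;> simp only [Fin.zero_eta, Fin.mk_one, Fin.isValue]
    · rw [e00]
      exact (norm_add_le _ _).trans (by gcongr; exact bound _ _ hc hd)
    · rw [e01]
      exact (bound _ _ hd hd).trans (by linarith [norm_nonneg a])
    · rw [e10, norm_neg]
      exact (bound _ _ hc hc).trans (by linarith [norm_nonneg a])
    · rw [e11]
      exact (norm_sub_le _ _).trans (by gcongr; exact bound _ _ hc hd)
  · simp only [e00, e01, e10, bottomSq]
    refine Prod.ext ?_ (Prod.ext ?_ ?_)
    · field_simp
    · simp only
      field_simp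
      ring
    · field_simp

theorem pow_apply_one (γ : SL(2, ℂ)) (h : γ 1 0 = 0) (n : ℕ) :
    (γ ^ n) 1 0 = 0 ∧ (γ ^ n) 1 1 = γ 1 1 ^ n := by
  induction n with
  | zero => simp
  | succ n ih => rw [pow_succ, mul_apply, mul_apply, ih.1, ih.2, h]; simp [pow_succ]

/-- If the modulus were less than `1`, the powers of `γ` would have infinitely many bounded bottom
rows. -/
theorem one_le_norm_of_fixes_infty
    (hcusp : IsParabolicFixedPoint Γ (OnePoint.infty : OnePoint ℂ))
    {γ : SL(2, ℂ)} (hγ : γ ∈ Γ) (h : γ 1 0 = 0) : 1 ≤ ‖γ 1 1‖ := by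
  by_contra! hlt
  have hpos : 0 < ‖γ 1 1‖ := norm_pos_iff.2 (bottom_row_ne_zero γ h)
  refine Set.infinite_of_injective_forall_mem (f := fun n : ℕ => bottomSq (γ ^ n)) ?_ ?_
    (finite_bottomSq hcusp 1)
  · intro m n hmn
    have h1 := congrArg (fun p : ℂ × ℂ × ℂ => ‖p.2.2‖) hmn
    simp only [bottomSq, (pow_apply_one γ h _).2, norm_pow, ← pow_mul] at h1
    have := pow_right_injective₀ hpos hlt.ne h1
    simpa using this
  · intro n
    refine ⟨γ ^ n, ⟨Γ.pow_mem hγ n, ?_, ?_⟩, rfl⟩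
    · rw [(pow_apply_one γ h n).1]
      simp
    · rw [(pow_apply_one γ h n).2, norm_pow]
      exact pow_le_one₀ hpos.le hlt.le

/-- The stabilizer of a cusp at `∞` acts on `ℂ` by Euclidean isometries. -/
theorem norm_eq_one_of_fixes_infty
    (hcusp : IsParabolicFixedPoint Γ (OnePoint.infty : OnePoint ℂ))
    {γ : SL(2, ℂ)} (hγ : γ ∈ Γ) (h : γ 1 0 = 0) : ‖γ 0 0‖ = 1 ∧ ‖γ 1 1‖ = 1 := by
  have h1 := one_le_norm_of_fixes_infty hcusp hγ h
  have h2 := one_le_norm_of_fixes_infty hcusp (Γ.inv_mem hγ)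
    (by rw [inv_apply_one_zero, h, neg_zero])
  rw [inv_apply_one_one] at h2
  have hdet := congrArg norm (det_eq γ)
  rw [h, mul_zero, sub_zero, norm_mul, norm_one] at hdet
  constructor <;> nlinarith

end Discrete

/-! ### Loxodromic elements -/

theorem conj_diag_apply (k : SL(2, ℂ)) (u : ℂˣ) :
    (k * diag u * k⁻¹) 1 0 = k 1 0 * k 1 1 * (u - (u : ℂ)⁻¹) ∧
    (k * diag u * k⁻¹) 1 1 = (u : ℂ)⁻¹ - k 0 1 * k 1 0 * (u - (u : ℂ)⁻¹) ∧
    (k * diag u * k⁻¹) 0 0 = u + k 0 1 * k 1 0 * (u - (u : ℂ)⁻¹) := by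
  have hdet := det_eq k
  simp only [mul_apply, inv_apply_one_zero, inv_apply_one_one, inv_apply_zero_zero,
    inv_apply_zero_one, diag_zero_zero, diag_one_one, diag_zero_one, diag_one_zero,
    Units.val_inv_eq_inv_val]
  refine ⟨by ring, ?_, ?_⟩
  · linear_combination (u : ℂ)⁻¹ * hdet
  · linear_combination (u : ℂ) * hdet

theorem conj_diag_zpow (k : SL(2, ℂ)) (u : ℂˣ) (n : ℤ) :
    (k * diag u * k⁻¹) ^ n = k * diag (u ^ n) * k⁻¹ := by
  rw [conj_zpow, map_zpow]

theorem sub_inv_ne_zero {u : ℂˣ} (hu : 1 < ‖(u : ℂ)‖) : (u : ℂ) - (u : ℂ)⁻¹ ≠ 0 := by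
  intro h
  have h1 := congrArg norm (sub_eq_zero.1 h)
  rw [norm_inv] at h1
  exact absurd h1 (((inv_lt_one_of_one_lt₀ hu).trans hu).ne')

theorem conjugatesToScrew_iff (g γ : SL(2, ℂ)) (l : ℂ) :
    ConjugatesToScrew g γ l ↔
      γ = g⁻¹ * diag (Units.mk0 (Complex.exp (l / 2)) (Complex.exp_ne_zero _)) * g⁻¹⁻¹ := by
  have h : ConjugatesToScrew g γ l ↔
      g * γ * g⁻¹ = diag (Units.mk0 (Complex.exp (l / 2)) (Complex.exp_ne_zero _)) := by
    rw [ConjugatesToScrew, neg_div, Complex.exp_neg]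
    exact ⟨fun h => Subtype.ext h, fun h => congrArg Subtype.val h⟩
  rw [h, inv_inv]
  constructor
  · intro h
    rw [← h]
    group
  · intro h
    rw [h]
    group

theorem one_lt_norm_exp_iff (l : ℂ) : 1 < ‖Complex.exp (l / 2)‖ ↔ 0 < l.re := by
  rw [Complex.norm_exp, Real.one_lt_exp_iff]
  simp

/-- Loxodromic elements are the conjugates of diagonal matrices with an eigenvalue of modulus
greater than `1`. -/
theorem isLoxodromic_iff (γ : SL(2, ℂ)) :
    IsLoxodromic γ ↔ ∃ (k : SL(2, ℂ)) (u : ℂˣ), 1 < ‖(u : ℂ)‖ ∧ γ = k * diag u * k⁻¹ := by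
  constructor
  · rintro ⟨g, l, hl, h⟩
    exact ⟨g⁻¹, _, (one_lt_norm_exp_iff l).2 hl, (conjugatesToScrew_iff g γ l).1 h⟩
  · rintro ⟨k, u, hu, h⟩
    have hexp : Complex.exp (2 * Complex.log u / 2) = u := by
      rw [mul_div_cancel_left₀ _ two_ne_zero, Complex.exp_log u.ne_zero]
    refine ⟨k⁻¹, 2 * Complex.log u, (one_lt_norm_exp_iff _).1 (by rwa [hexp]), ?_⟩
    rw [conjugatesToScrew_iff, h, inv_inv]
    congr 3
    exact Units.ext hexp.symm

section Discrete

variable {Γ : Subgroup SL(2, ℂ)} [DiscreteTopology Γ]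

/-- A loxodromic element of `Γ` does not fix the cusp `∞`. -/
theorem bottom_row_ne_zero_of_loxodromic
    (hcusp : IsParabolicFixedPoint Γ (OnePoint.infty : OnePoint ℂ)) {k : SL(2, ℂ)} {u : ℂˣ}
    (hu : 1 < ‖(u : ℂ)‖) (hmem : k * diag u * k⁻¹ ∈ Γ) : k 1 0 ≠ 0 ∧ k 1 1 ≠ 0 := by
  obtain ⟨h10, h11, h00⟩ := conj_diag_apply k u
  have hdet := det_eq k
  constructor
  · intro h
    have h1 := norm_eq_one_of_fixes_infty hcusp hmem (by rw [h10, h]; ring)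
    rw [h00, h, mul_zero, zero_mul, add_zero] at h1
    exact hu.ne' h1.1
  · intro h
    have h1 := norm_eq_one_of_fixes_infty hcusp hmem (by rw [h10, h]; ring)
    rw [h, mul_zero, zero_sub, neg_eq_iff_eq_neg] at hdet
    rw [h11, hdet, neg_one_mul, sub_neg_eq_add, add_sub_cancel] at h1
    exact hu.ne' h1.2

/-- A parabolic element of `Γ` does not fix a fixed point of a loxodromic element of `Γ`:
otherwise the conjugates of the former by the powers of the latter would accumulate. -/
theorem not_isParabolicFixedPoint_of_loxodromic {k : SL(2, ℂ)} {u : ℂˣ}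
    (hu : 1 < ‖(u : ℂ)‖) (hmem : k * diag u * k⁻¹ ∈ Γ) :
    ¬ IsParabolicFixedPoint Γ (k • (OnePoint.infty : OnePoint ℂ)) := by
  rintro ⟨ρ, hρ, hpar, hfix⟩
  set m := k⁻¹ * ρ * k with hm
  have hm10 : m 1 0 = 0 := by
    rw [← smul_infty_eq_infty_iff, hm, mul_smul, mul_smul, hfix, inv_smul_smul]
  have hmpar : (m : Matrix (Fin 2) (Fin 2) ℂ).IsParabolic := by
    have h : ((Matrix.SpecialLinearGroup.toGL k)⁻¹ * Matrix.SpecialLinearGroup.toGL ρ *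
        Matrix.SpecialLinearGroup.toGL k).IsParabolic :=
      (Matrix.GeneralLinearGroup.isParabolic_conj_iff' _ _).2 hpar
    rw [← map_inv, ← map_mul, ← map_mul] at h
    exact h
  obtain ⟨h00, h01⟩ := (Matrix.isParabolic_iff_of_upperTriangular hm10).1 hmpar
  have hu0 : 0 < ‖(u : ℂ)‖ := one_pos.trans hu
  have key : ∀ n : ℕ, (diag (u ^ (-n : ℤ)) * m * diag (u ^ (n : ℤ))) 0 0 = m 1 1 ∧
      (diag (u ^ (-n : ℤ)) * m * diag (u ^ (n : ℤ))) 0 1 = m 0 1 * ((u : ℂ)⁻¹ ^ 2) ^ n ∧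
      (diag (u ^ (-n : ℤ)) * m * diag (u ^ (n : ℤ))) 1 0 = 0 ∧
      (diag (u ^ (-n : ℤ)) * m * diag (u ^ (n : ℤ))) 1 1 = m 1 1 := by
    intro n
    have hun : (u : ℂ) ^ n ≠ 0 := pow_ne_zero _ u.ne_zero
    simp only [mul_apply, diag_zero_zero, diag_one_one, diag_zero_one, diag_one_zero, hm10, h00,
      zpow_neg, zpow_natCast, inv_inv, Units.val_inv_eq_inv_val, Units.val_pow_eq_pow_val]
    refine ⟨?_, ?_, by ring, ?_⟩
    · field_simp
      ring
    · rw [inv_pow, inv_pow]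
      field_simp
      ring
    · field_simp
      ring
  have hK := (isCompact_setOf_norm_le (‖m 1 1‖ + ‖m 0 1‖)).image
    (f := fun M : SL(2, ℂ) => k * M * k⁻¹) (by fun_prop)
  refine Set.infinite_of_injective_forall_mem
    (f := fun n : ℕ => k * (diag (u ^ (-n : ℤ)) * m * diag (u ^ (n : ℤ))) * k⁻¹) ?_ ?_
    (finite_inter_of_isCompact (Γ := Γ) hK)
  · intro n n' hnn
    have h1 := mul_left_cancel (mul_right_cancel hnn)
    have h2 := congrArg (fun M : SL(2, ℂ) => M 0 1) h1
    simp only [(key _).2.1] at h2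
    have h3 : ‖((u : ℂ)⁻¹ ^ 2) ^ n‖ = ‖((u : ℂ)⁻¹ ^ 2) ^ n'‖ :=
      congrArg norm (mul_left_cancel₀ h01 h2)
    simp only [norm_pow, norm_inv] at h3
    have hr0 : 0 < ‖(u : ℂ)‖⁻¹ ^ 2 := by positivity
    have hr1 : ‖(u : ℂ)‖⁻¹ ^ 2 < 1 :=
      pow_lt_one₀ (by positivity) (inv_lt_one_of_one_lt₀ hu) two_ne_zero
    exact pow_right_injective₀ hr0 hr1.ne h3
  · intro n
    constructor
    · have : k * (diag (u ^ (-n : ℤ)) * m * diag (u ^ (n : ℤ))) * k⁻¹ =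
          (k * diag u * k⁻¹) ^ (-n : ℤ) * ρ * (k * diag u * k⁻¹) ^ (n : ℤ) := by
        rw [conj_diag_zpow, conj_diag_zpow, hm]
        group
      rw [this]
      exact Γ.mul_mem (Γ.mul_mem (Γ.zpow_mem hmem _) hρ) (Γ.zpow_mem hmem _)
    · refine ⟨_, ?_, rfl⟩
      have hle : ‖m 0 1 * ((u : ℂ)⁻¹ ^ 2) ^ n‖ ≤ ‖m 0 1‖ := by
        rw [norm_mul, norm_pow, norm_pow, norm_inv]
        refine mul_le_of_le_one_right (norm_nonneg _) (pow_le_one₀ (by positivity) ?_)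
        exact pow_le_one₀ (by positivity) (inv_le_one_of_one_le₀ hu.le)
      have n1 := norm_nonneg (m 1 1)
      have n2 := norm_nonneg (m 0 1)
      intro i j
      fin_cases i <;> fin_cases j <;> simp only [Fin.zero_eta, Fin.mk_one, Fin.isValue]
      · rw [(key n).1]; linarith
      · rw [(key n).2.1]; linarith
      · rw [(key n).2.2.1, norm_zero]; linarith
      · rw [(key n).2.2.2]; linarith

end Discrete

/-! ### Heights of axes -/

theorem height_conj_diag (k : SL(2, ℂ)) {u : ℂˣ} (hu : 1 < ‖(u : ℂ)‖) :
    height (k * diag u * k⁻¹) = 1 / (2 * (‖k 1 0‖ * ‖k 1 1‖)) := by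
  obtain ⟨h10, h11, h00⟩ := conj_diag_apply k u
  have hne : ‖(u : ℂ) - (u : ℂ)⁻¹‖ ≠ 0 := norm_ne_zero_iff.2 (sub_inv_ne_zero hu)
  have htr : ((k * diag u * k⁻¹ : SL(2, ℂ)) : Matrix (Fin 2) (Fin 2) ℂ).trace ^ 2 - 4
      = ((u : ℂ) - (u : ℂ)⁻¹) ^ 2 := by
    have := mul_inv_cancel₀ u.ne_zero
    rw [Matrix.trace_fin_two, h00, h11]
    linear_combination 4 * this
  rw [height, htr, norm_pow, Real.sqrt_sq (norm_nonneg _), h10, norm_mul, norm_mul]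
  rw [← mul_assoc, mul_comm _ ‖(u : ℂ) - (u : ℂ)⁻¹‖, div_mul_cancel_left₀ hne, one_div]

theorem conj_conj_diag (δ k : SL(2, ℂ)) (u : ℂˣ) :
    δ * (k * diag u * k⁻¹) * δ⁻¹ = δ * k * diag u * (δ * k)⁻¹ := by
  group

section Discrete

variable {Γ : Subgroup SL(2, ℂ)} [DiscreteTopology Γ]

theorem isGreatest_height (hcusp : IsParabolicFixedPoint Γ (OnePoint.infty : OnePoint ℂ))
    {γ : SL(2, ℂ)} (hγ : γ ∈ Γ) (hlox : IsLoxodromic γ) :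
    IsGreatest {s : ℝ | ∃ x ∈ loxodromicAxis γ, x.t = s} (height γ) := by
  constructor
  · obtain ⟨g, l, hl, h⟩ := hlox
    have h' := (conjugatesToScrew_iff g γ l).1 h
    have hu := (one_lt_norm_exp_iff l).2 hl
    set k := g⁻¹ with hk
    set u := Units.mk0 (Complex.exp (l / 2)) (Complex.exp_ne_zero _)
    obtain ⟨hk0, hk1⟩ := bottom_row_ne_zero_of_loxodromic hcusp (k := k) (u := u) hu (h' ▸ hγ)
    have n0 : 0 < ‖k 1 0‖ := norm_pos_iff.2 hk0
    have n1 : 0 < ‖k 1 1‖ := norm_pos_iff.2 hk1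
    -- the highest point of `k • (0, s)` is at `s = |k₁₁| / |k₁₀|`
    refine ⟨k • H3.onAxis (‖k 1 1‖ / ‖k 1 0‖) (div_pos n1 n0), ⟨g, l, hl, h, ?_⟩, ?_⟩
    · exact congrArg H3.z (H3.smul_inv_smul' g _)
    · rw [h', height_conj_diag k hu, H3.smul_t, H3.denom_onAxis]
      simp only [H3.onAxis]
      field_simp
      ring
  · rintro _ ⟨x, ⟨g, l, hl, h, hx⟩, rfl⟩
    have h' := (conjugatesToScrew_iff g γ l).1 h
    have hu := (one_lt_norm_exp_iff l).2 hl
    set k := g⁻¹ with hk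
    set u := Units.mk0 (Complex.exp (l / 2)) (Complex.exp_ne_zero _)
    obtain ⟨hk0, hk1⟩ := bottom_row_ne_zero_of_loxodromic hcusp (k := k) (u := u) hu (h' ▸ hγ)
    have n0 : 0 < ‖k 1 0‖ := norm_pos_iff.2 hk0
    have n1 : 0 < ‖k 1 1‖ := norm_pos_iff.2 hk1
    have hpos := (g • x).t_pos
    have hx' : x = k • H3.onAxis (g • x).t hpos := by
      conv_lhs => rw [← H3.inv_smul_smul' g x]
      congr 1
      exact H3.ext hx rfl
    rw [hx', h', height_conj_diag k hu, H3.smul_t, H3.denom_onAxis]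
    simp only [H3.onAxis]
    set s := (g • x).t
    rw [div_le_div_iff₀ (by positivity) (by positivity)]
    nlinarith [sq_nonneg (‖k 1 0‖ * s - ‖k 1 1‖)]

/-- A segment of the axis of a loxodromic element `k * diag u * k⁻¹` of `Γ` that is a fundamental
domain for its action sees every horoball: up to powers of this element, the highest point of the
translate `δ • axis` is the translate of a point of this segment. -/
theorem exists_balanced (hcusp : IsParabolicFixedPoint Γ (OnePoint.infty : OnePoint ℂ))
    {k : SL(2, ℂ)} {u : ℂˣ} (hu : 1 < ‖(u : ℂ)‖) (hmem : k * diag u * k⁻¹ ∈ Γ)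
    {δ : SL(2, ℂ)} (hδ : δ ∈ Γ) :
    ∃ δ' ∈ Γ, ‖(δ' * k) 1 0‖ * ‖(δ' * k) 1 1‖ = ‖(δ * k) 1 0‖ * ‖(δ * k) 1 1‖ ∧
      ‖(δ' * k) 1 0‖ ≤ ‖(δ' * k) 1 1‖ ∧ ‖(δ' * k) 1 1‖ ≤ ‖(u : ℂ)‖ ^ 2 * ‖(δ' * k) 1 0‖ := by
  have hmem' : δ * k * diag u * (δ * k)⁻¹ ∈ Γ := by
    rw [← conj_conj_diag]
    exact Γ.mul_mem (Γ.mul_mem hδ hmem) (Γ.inv_mem hδ)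
  obtain ⟨h0, h1⟩ := bottom_row_ne_zero_of_loxodromic hcusp hu hmem'
  have n0 : 0 < ‖(δ * k) 1 0‖ := norm_pos_iff.2 h0
  have n1 : 0 < ‖(δ * k) 1 1‖ := norm_pos_iff.2 h1
  have hu0 : 0 < ‖(u : ℂ)‖ := one_pos.trans hu
  obtain ⟨n, hn1, hn2⟩ := exists_mem_Ico_zpow (div_pos n1 n0)
    (one_lt_pow₀ hu (two_ne_zero (α := ℕ)))
  rw [le_div_iff₀ n0] at hn1
  rw [div_lt_iff₀ n0] at hn2
  have hpos : 0 < ‖(u : ℂ)‖ ^ n := zpow_pos hu0 n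
  have hsq : (‖(u : ℂ)‖ ^ 2) ^ n = ‖(u : ℂ)‖ ^ n * ‖(u : ℂ)‖ ^ n := by
    rw [← mul_zpow, sq]
  have e : δ * (k * diag u * k⁻¹) ^ n * k = δ * k * diag (u ^ n) := by
    rw [conj_diag_zpow]
    group
  refine ⟨δ * (k * diag u * k⁻¹) ^ n, Γ.mul_mem hδ (Γ.zpow_mem hmem n), ?_⟩
  have e0 : ‖(δ * k * diag (u ^ n)) 1 0‖ = ‖(δ * k) 1 0‖ * ‖(u : ℂ)‖ ^ n := by
    rw [mul_diag_apply_zero, norm_mul, Units.val_zpow_eq_zpow_val, norm_zpow]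
  have e1 : ‖(δ * k * diag (u ^ n)) 1 1‖ = ‖(δ * k) 1 1‖ / ‖(u : ℂ)‖ ^ n := by
    rw [mul_diag_apply_one, norm_mul, norm_inv, Units.val_zpow_eq_zpow_val, norm_zpow,
      div_eq_mul_inv]
  rw [e, e0, e1]
  rw [zpow_add₀ (by positivity), zpow_one, hsq] at hn2
  rw [hsq] at hn1
  refine ⟨by field_simp, ?_, ?_⟩
  · rw [le_div_iff₀ hpos]
    linarith
  · rw [div_le_iff₀ hpos]
    linarith

theorem exists_isGreatest_height_conj
    (hcusp : IsParabolicFixedPoint Γ (OnePoint.infty : OnePoint ℂ))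
    {γ : SL(2, ℂ)} (hγ : γ ∈ Γ) (hlox : IsLoxodromic γ) :
    ∃ m : ℝ, IsGreatest {s : ℝ | ∃ δ ∈ Γ, s = height (δ * γ * δ⁻¹)} m := by
  obtain ⟨k, u, hu, rfl⟩ := (isLoxodromic_iff γ).1 hlox
  set B := ‖k 1 0‖ * ‖k 1 1‖ with hB
  obtain ⟨hk0, hk1⟩ := bottom_row_ne_zero_of_loxodromic hcusp hu hγ
  have n0 : 0 < ‖k 1 0‖ := norm_pos_iff.2 hk0
  have n1 : 0 < ‖k 1 1‖ := norm_pos_iff.2 hk1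
  have hBpos : 0 < B := mul_pos n0 n1
  set S := {s : ℝ | ∃ δ ∈ Γ, s = height (δ * (k * diag u * k⁻¹) * δ⁻¹)} with hS
  -- a balanced row `(x, y) = (δ * k) 1` with `|x y| ≤ B` has `|y| ≤ ρ`
  set ρ := ‖(u : ℂ)‖ * B + ‖(u : ℂ)‖ with hρ
  set N := ‖k 0 0‖ + ‖k 0 1‖ + ‖k 1 0‖ + ‖k 1 1‖ with hN
  set f : ℂ × ℂ × ℂ → ℝ := fun q => 1 / (2 * ‖q.1 * (k 0 0 * k 0 1) +
    q.2.1 * (k 0 0 * k 1 1 + k 0 1 * k 1 0) + q.2.2 * (k 1 0 * k 1 1)‖) with hf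
  have hfin : {s ∈ S | 1 / (2 * B) ≤ s}.Finite := by
    refine ((finite_bottomSq hcusp (ρ * N)).image f).subset ?_
    rintro s ⟨⟨δ, hδ, rfl⟩, hs⟩
    rw [conj_conj_diag, height_conj_diag _ hu] at hs ⊢
    obtain ⟨δ', hδ', heq, hle, hge⟩ := exists_balanced hcusp hu hγ hδ
    rw [← heq] at hs ⊢
    set x := (δ' * k) 1 0 with hx
    set y := (δ' * k) 1 1 with hy
    have hxy : ‖x‖ * ‖y‖ ≤ B := by
      rcases (mul_nonneg (norm_nonneg x) (norm_nonneg y)).eq_or_lt with h0 | h0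
      · rw [← h0]; exact hBpos.le
      · have := (one_div_le_one_div (by positivity) (by positivity)).1 hs
        linarith
    have hu0 : 0 < ‖(u : ℂ)‖ := one_pos.trans hu
    have hyρ : ‖y‖ ≤ ρ := by
      have h1 : ‖y‖ ^ 2 ≤ ‖(u : ℂ)‖ ^ 2 * B := by
        nlinarith [norm_nonneg y, norm_nonneg x,
          mul_le_mul_of_nonneg_left hxy (sq_nonneg ‖(u : ℂ)‖)]
      refine abs_le_of_sq_le_sq' (h1.trans ?_) (by positivity) |>.2
      have : ρ = ‖(u : ℂ)‖ * (B + 1) := by rw [hρ]; ring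
      rw [this, mul_pow]
      gcongr
      nlinarith
    have hxρ : ‖x‖ ≤ ρ := hle.trans hyρ
    have hrow0 : δ' 1 0 = x * k 1 1 - y * k 1 0 := by
      rw [hx, hy, mul_apply, mul_apply]
      linear_combination (-δ' 1 0) * det_eq k
    have hrow1 : δ' 1 1 = y * k 0 0 - x * k 0 1 := by
      rw [hx, hy, mul_apply, mul_apply]
      linear_combination (-δ' 1 1) * det_eq k
    have hbound : ∀ p q : ℂ, ‖p‖ + ‖q‖ ≤ N → ‖x * p - y * q‖ ≤ ρ * N := by
      intro p q hpq
      calc ‖x * p - y * q‖ ≤ ‖x * p‖ + ‖y * q‖ := norm_sub_le _ _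
        _ ≤ ρ * ‖p‖ + ρ * ‖q‖ := by
          rw [norm_mul, norm_mul]
          gcongr
        _ = ρ * (‖p‖ + ‖q‖) := by ring
        _ ≤ ρ * N := by gcongr
    have m0 := norm_nonneg (k 0 0)
    have m1 := norm_nonneg (k 0 1)
    refine ⟨bottomSq δ', ⟨δ', ⟨hδ', ?_, ?_⟩, rfl⟩, ?_⟩
    · rw [hrow0]
      exact hbound _ _ (by rw [hN]; linarith)
    · rw [hrow1, norm_sub_rev]
      exact hbound _ _ (by rw [hN]; linarith)
    · simp only [hf, bottomSq]
      rw [← norm_mul, hx, hy, mul_apply, mul_apply]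
      congr 3
      ring
  have h1S : 1 / (2 * B) ∈ {s ∈ S | 1 / (2 * B) ≤ s} := by
    refine ⟨⟨1, Γ.one_mem, ?_⟩, le_rfl⟩
    rw [one_mul, inv_one, mul_one, height_conj_diag k hu]
  obtain ⟨m, hm, hmax⟩ := Set.exists_max_image _ id hfin ⟨_, h1S⟩
  refine ⟨m, hm.1, fun s hs => ?_⟩
  rcases le_total (1 / (2 * B)) s with h | h
  · exact hmax s ⟨hs, h⟩
  · exact h.trans hm.2

end Discrete

/-! ### Depth and approximation by rational lines -/

theorem H3.hdist_vertical {x y : H3} (hz : x.z = y.z) (ht : y.t ≤ x.t) :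
    H3.hdist x y = Real.log x.t - Real.log y.t := by
  have hx := x.t_pos
  have hy := y.t_pos
  have hA : 0 < √x.t := Real.sqrt_pos.2 hx
  have hB : 0 < √y.t := Real.sqrt_pos.2 hy
  have h1 : √(‖x.z - y.z‖ ^ 2 + (x.t - y.t) ^ 2) / (2 * √(x.t * y.t))
      = Real.sinh (Real.log (√x.t / √y.t)) := by
    rw [hz, sub_self, norm_zero, zero_pow two_ne_zero, zero_add,
      Real.sqrt_sq (sub_nonneg.2 ht), Real.sqrt_mul hx.le, Real.sinh_log (div_pos hA hB)]
    field_simp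
    rw [Real.sq_sqrt hx.le, Real.sq_sqrt hy.le]
  rw [H3.hdist, h1, Real.arsinh_sinh, Real.log_div hA.ne' hB.ne', Real.log_sqrt hx.le,
    Real.log_sqrt hy.le]
  ring

theorem one_le_norm_of_isCuspNormalized {Γ : Subgroup SL(2, ℂ)} (hnorm : IsCuspNormalized Γ)
    {γ : SL(2, ℂ)} (hγ : γ ∈ Γ) (hc : γ 1 0 ≠ 0) : 1 ≤ ‖γ 1 0‖ := by
  by_contra! hlt
  have hpos : 0 < ‖γ 1 0‖ := norm_pos_iff.2 hc
  -- the image of the horosphere at height `1 / |c|` is tangent to this horosphere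
  have h1 : 1 < ‖γ 1 0‖⁻¹ := (one_lt_inv₀ hpos).2 hlt
  have hdisj := (hnorm _ (one_pos.trans h1)).2 h1 γ hγ
    (fun h => hc ((smul_infty_eq_infty_iff γ).1 h))
  set x : H3 := ⟨-γ 1 1 / γ 1 0, ‖γ 1 0‖⁻¹, one_pos.trans h1⟩ with hx
  have hden : H3.denom γ x = 1 := by
    rw [H3.denom, hx]
    simp only
    rw [mul_div_cancel₀ _ hc, neg_add_cancel, map_zero, zero_add, Complex.normSq_eq_norm_sq,
      ← mul_pow, mul_inv_cancel₀ hpos.ne', one_pow]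
  have hmem : γ • x ∈ horosphere ‖γ 1 0‖⁻¹ := by
    change (γ • x).t = ‖γ 1 0‖⁻¹
    rw [H3.smul_t, hden, div_one]
  exact Set.disjoint_left.1 hdisj (Set.mem_image_of_mem _ (show x ∈ horosphere _ from rfl)) hmem

theorem CuspLine.HasEndpoint.exists_smul {Γ : Subgroup SL(2, ℂ)} {ξ : CuspLine Γ} {p q : ℂ} (hp : ξ.HasEndpoint p)
    (hq : ξ.HasEndpoint q) : ∃ δ ∈ Γ, δ 1 0 = 0 ∧ δ • (p : OnePoint ℂ) = q := by
  obtain ⟨δ, hδ, h1, h2⟩ := Quotient.exact (hp.trans hq.symm)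
  exact ⟨δ, hδ, (smul_infty_eq_infty_iff δ).1 h1, h2⟩

theorem CuspLine.HasEndpoint.of_smul {Γ : Subgroup SL(2, ℂ)} {ξ : CuspLine Γ} {p q : ℂ} (hp : ξ.HasEndpoint p)
    {δ : SL(2, ℂ)} (hδ : δ ∈ Γ) (h : δ 1 0 = 0) (hq : δ • (p : OnePoint ℂ) = q) :
    ξ.HasEndpoint q := by
  have hpq : (linkSetoid Γ).r p q := ⟨δ, hδ, (smul_infty_eq_infty_iff δ).2 h, hq⟩
  rw [← hp]
  exact (Quotient.sound hpq).symm

theorem CuspLine.ldist_le {Γ : Subgroup SL(2, ℂ)} {ξ r : CuspLine Γ} {p q : ℂ} (hp : ξ.HasEndpoint p)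
    (hq : r.HasEndpoint q) : ξ.ldist r ≤ dist p q :=
  csInf_le ⟨0, by rintro _ ⟨p, q, -, -, rfl⟩; exact dist_nonneg⟩ ⟨p, q, hp, hq, rfl⟩

section Discrete

variable {Γ : Subgroup SL(2, ℂ)} [DiscreteTopology Γ]

/-- The entry `|c|` of an element of `Γ` depends only on the image of `∞`, up to the stabilizer
of `∞`. -/
theorem norm_lower_left_eq (hcusp : IsParabolicFixedPoint Γ (OnePoint.infty : OnePoint ℂ))
    {γ γ' δ : SL(2, ℂ)} (hγ : γ ∈ Γ) (hγ' : γ' ∈ Γ) (hδ : δ ∈ Γ) (h : δ 1 0 = 0)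
    (heq : γ' • (OnePoint.infty : OnePoint ℂ) = δ • γ • (OnePoint.infty : OnePoint ℂ)) :
    ‖γ' 1 0‖ = ‖γ 1 0‖ := by
  have hε : ((δ * γ)⁻¹ * γ') 1 0 = 0 := by
    rw [← smul_infty_eq_infty_iff, mul_smul, heq, ← mul_smul δ, inv_smul_smul]
  have hmem : (δ * γ)⁻¹ * γ' ∈ Γ := Γ.mul_mem (Γ.inv_mem (Γ.mul_mem hδ hγ)) hγ'
  have h1 := (norm_eq_one_of_fixes_infty hcusp hmem hε).1
  have h2 := (norm_eq_one_of_fixes_infty hcusp hδ h).2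
  have h3 : γ' = δ * γ * ((δ * γ)⁻¹ * γ') := by group
  rw [h3, mul_apply, hε, mul_zero, add_zero, mul_apply, h, zero_mul, zero_add, norm_mul, norm_mul,
    h1, h2, one_mul, mul_one]

theorem CuspLine.depth_eq (hcusp : IsParabolicFixedPoint Γ (OnePoint.infty : OnePoint ℂ))
    (hnorm : IsCuspNormalized Γ) {r : CuspLine Γ} {p : ℂ} (hp : r.HasEndpoint p)
    {γ : SL(2, ℂ)} (hγ : γ ∈ Γ) (hγp : γ • (OnePoint.infty : OnePoint ℂ) = p) :
    r.depth = 2 * Real.log ‖γ 1 0‖ := by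
  have hset : {D | ∃ p : ℂ, r.HasEndpoint p ∧ ∃ γ ∈ Γ, γ • (OnePoint.infty : OnePoint ℂ) = p ∧
    ∃ x ∈ horosphere (Real.exp 1), ∃ y ∈ (fun x => γ • x) '' horosphere (Real.exp 1),
      x.z = p ∧ y.z = p ∧ D = H3.hdist x y - 2} = {2 * Real.log ‖γ 1 0‖} := by
    have key : ∀ {p : ℂ} {γ : SL(2, ℂ)}, γ ∈ Γ → γ • (OnePoint.infty : OnePoint ℂ) = p →
        ∀ {x y : H3}, x.t = Real.exp 1 → x.z = p → y.z = p →
        y.t = 1 / (‖γ 1 0‖ ^ 2 * Real.exp 1) → H3.hdist x y - 2 = 2 * Real.log ‖γ 1 0‖ := by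
      intro p γ hγ hγp x y hxt hxz hyz hyt
      have hc := ((smul_infty_eq_coe_iff γ p).1 hγp).1
      have h1 := one_le_norm_of_isCuspNormalized hnorm hγ hc
      have he : 1 ≤ Real.exp 1 := Real.one_le_exp zero_le_one
      have hle : y.t ≤ x.t := by
        rw [hxt, hyt, div_le_iff₀ (by positivity)]
        have : 1 ≤ ‖γ 1 0‖ ^ 2 := one_le_pow₀ h1
        nlinarith [mul_le_mul he he zero_le_one (zero_le_one.trans he)]
      rw [H3.hdist_vertical (hxz.trans hyz.symm) hle, hxt, hyt, Real.log_exp, one_div,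
        Real.log_inv, Real.log_mul (by positivity) (by positivity), Real.log_exp, Real.log_pow]
      push_cast
      ring
    ext D
    rw [Set.mem_singleton_iff]
    constructor
    · rintro ⟨p', hp', γ', hγ', hγp', x, hx, _, ⟨w, hw, rfl⟩, hxz, hyz, rfl⟩
      obtain ⟨δ, hδ, hδ0, hδp⟩ := hp.exists_smul hp'
      rw [← norm_lower_left_eq hcusp hγ hγ' hδ hδ0 (by rw [hγp', hγp, hδp])]
      obtain ⟨hc, ha⟩ := (smul_infty_eq_coe_iff γ' p').1 hγp'
      refine key hγ' hγp' hx hxz hyz ?_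
      have hden : (H3.denom γ' w : ℂ) ≠ 0 := by exact_mod_cast (H3.denom_pos γ' w).ne'
      have hD := H3.coe_denom γ' w
      -- the point of the horosphere above its center is the image of the point above `γ'⁻¹ ∞`
      have hz : γ' 1 0 * w.z + γ' 1 1 = 0 := by
        have h1 : (γ' 0 0 * w.z + γ' 0 1) * star (γ' 1 0 * w.z + γ' 1 1)
            + γ' 0 0 * star (γ' 1 0) * w.t ^ 2 = p' * H3.denom γ' w :=
          (div_eq_iff hden).1 hyz
        have h2 : γ' 1 0 * (γ' 0 1 - p' * γ' 1 1) = -1 := by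
          linear_combination (-1 : ℂ) * det_eq γ' + γ' 1 1 * ha
        have h3 : (γ' 0 1 - p' * γ' 1 1) * star (γ' 1 0 * w.z + γ' 1 1) = 0 := by
          rw [hD] at h1
          linear_combination h1 - (w.z * star (γ' 1 0 * w.z + γ' 1 1)
            + star (γ' 1 0) * w.t ^ 2) * ha
        rcases mul_eq_zero.1 h3 with h4 | h4
        · rw [h4, mul_zero] at h2
          simp at h2
        · exact star_eq_zero.1 h4
      have hwt : w.t = Real.exp 1 := hw
      simp only [H3.smul_t, H3.denom, hz, map_zero, zero_add, Complex.normSq_eq_norm_sq, hwt]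
      have : ‖γ' 1 0‖ ≠ 0 := norm_ne_zero_iff.2 hc
      field_simp
    · rintro rfl
      obtain ⟨hc, ha⟩ := (smul_infty_eq_coe_iff γ p).1 hγp
      set w : H3 := ⟨-γ 1 1 / γ 1 0, Real.exp 1, Real.exp_pos 1⟩ with hw
      have hwz : γ 1 0 * w.z + γ 1 1 = 0 := by
        rw [hw]
        simp only
        rw [mul_div_cancel₀ _ hc, neg_add_cancel]
      have hc' : ‖γ 1 0‖ ≠ 0 := norm_ne_zero_iff.2 hc
      have hyz : (γ • w).z = p := by
        rw [H3.smul_z]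
        simp only [H3.denom, hwz, ha, star_zero, mul_zero, map_zero, zero_add,
          Complex.normSq_eq_norm_sq]
        push_cast
        have h1 : γ 1 0 * star (γ 1 0) = (‖γ 1 0‖ : ℂ) ^ 2 := Complex.mul_conj' _
        have h2 : (‖γ 1 0‖ : ℂ) ≠ 0 := by exact_mod_cast hc'
        have h3 : (w.t : ℂ) ≠ 0 := by exact_mod_cast w.t_pos.ne'
        rw [div_eq_iff (by positivity), ← h1]
        ring
      refine ⟨p, hp, γ, hγ, hγp, ⟨p, Real.exp 1, Real.exp_pos 1⟩, rfl, γ • w, ⟨w, rfl, rfl⟩, rfl,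
        hyz, (key hγ hγp rfl rfl hyz ?_).symm⟩
      have hwt : w.t = Real.exp 1 := rfl
      simp only [H3.smul_t, H3.denom, hwz, map_zero, zero_add, Complex.normSq_eq_norm_sq, hwt]
      field_simp
  rw [CuspLine.depth, hset, csInf_singleton]

theorem CuspLine.exp_neg_depth (hcusp : IsParabolicFixedPoint Γ (OnePoint.infty : OnePoint ℂ))
    (hnorm : IsCuspNormalized Γ) {r : CuspLine Γ} {p : ℂ} (hp : r.HasEndpoint p)
    {γ : SL(2, ℂ)} (hγ : γ ∈ Γ) (hγp : γ • (OnePoint.infty : OnePoint ℂ) = p) :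
    Real.exp (-r.depth) = 1 / ‖γ 1 0‖ ^ 2 := by
  have hc := ((smul_infty_eq_coe_iff γ p).1 hγp).1
  have hpos : 0 < ‖γ 1 0‖ := norm_pos_iff.2 hc
  rw [CuspLine.depth_eq hcusp hnorm hp hγ hγp, Real.exp_neg, two_mul, Real.exp_add,
    Real.exp_log hpos, one_div, sq]

theorem CuspLine.exists_endpoint_of_ldist_lt
    (hcusp : IsParabolicFixedPoint Γ (OnePoint.infty : OnePoint ℂ)) {ξ r : CuspLine Γ} {p : ℂ}
    (hp : ξ.HasEndpoint p) {X : ℝ} (h : ξ.ldist r < X) :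
    ∃ q : ℂ, r.HasEndpoint q ∧ dist p q < X := by
  obtain ⟨q₀, hq₀⟩ := Quotient.exists_rep r
  rw [CuspLine.ldist] at h
  obtain ⟨_, ⟨p', q', hp', hq', rfl⟩, hlt⟩ := exists_lt_of_csInf_lt (by exact ⟨_, p, q₀, hp, hq₀, rfl⟩) h
  obtain ⟨δ, hδ, hδ0, hδp⟩ := hp'.exists_smul hp
  have hδq := smul_coe_of_apply_one_zero δ hδ0 q'
  refine ⟨_, hq'.of_smul hδ hδ0 hδq, ?_⟩
  rw [smul_coe_of_apply_one_zero δ hδ0, OnePoint.coe_eq_coe] at hδp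
  have h1 := (norm_eq_one_of_fixes_infty hcusp hδ hδ0).1
  have h2 : p - δ 0 0 * (δ 0 0 * q' + δ 0 1) = δ 0 0 * δ 0 0 * (p' - q') := by
    rw [← hδp]
    ring
  rwa [dist_eq_norm, h2, norm_mul, norm_mul, h1, one_mul, one_mul, ← dist_eq_norm]

/-- A bounded region of `ℂ` contains only finitely many centers of horoballs of `Γ` of Euclidean
diameter bounded below. -/
theorem finite_cusps (hcusp : IsParabolicFixedPoint Γ (OnePoint.infty : OnePoint ℂ)) (C R : ℝ) :
    {p : ℂ | ∃ γ ∈ Γ, γ • (OnePoint.infty : OnePoint ℂ) = p ∧ ‖γ 1 0‖ ≤ C ∧ ‖p‖ ≤ R}.Finite := by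
  refine ((finite_bottomSq hcusp (max C (R * C))).image
    (fun q : ℂ × ℂ × ℂ => -q.2.1 / q.1)).subset ?_
  rintro p ⟨γ, hγ, hp, hC, hR⟩
  obtain ⟨hc, ha⟩ := (smul_infty_eq_coe_iff γ p).1 hp
  refine ⟨bottomSq γ⁻¹, ⟨γ⁻¹, ⟨Γ.inv_mem hγ, ?_, ?_⟩, rfl⟩, ?_⟩
  · rw [inv_apply_one_zero, norm_neg]
    exact hC.trans (le_max_left _ _)
  · rw [inv_apply_one_one, ha, norm_mul]
    refine le_trans ?_ (le_max_right _ _)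
    exact mul_le_mul hR hC (norm_nonneg _) ((norm_nonneg _).trans hR)
  · simp only [bottomSq, inv_apply_one_zero, inv_apply_one_one, ha]
    field_simp

variable (Γ) in
/-- The points `γ ∞ = a / c` of the orbit of the cusp `∞` such that `|z - a / c| ≤ K / |c| ^ 2`. -/
def approximants (z : ℂ) (K : ℝ) : Set ℂ :=
  {p | ∃ γ ∈ Γ, γ • (OnePoint.infty : OnePoint ℂ) = p ∧ ‖z - p‖ * ‖γ 1 0‖ ^ 2 ≤ K}

/-- Each class modulo the stabilizer of `∞` contains only finitely many approximants, so finitely many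
approximating lines come from finitely many approximants. -/
theorem CuspLine.finite_approximants
    (hcusp : IsParabolicFixedPoint Γ (OnePoint.infty : OnePoint ℂ))
    (hnorm : IsCuspNormalized Γ) {ξ : CuspLine Γ} {z : ℂ} (hz : ξ.HasEndpoint z) {K : ℝ}
    (hfin : {r : CuspLine Γ | r.IsRational ∧ ξ.ldist r ≤ K * Real.exp (-r.depth)}.Finite) :
    (approximants Γ z K).Finite := by
  refine Set.Finite.of_finite_fibers (Quotient.mk (linkSetoid Γ)) (hfin.subset ?_) ?_
  · rintro _ ⟨p, ⟨γ, hγ, hp, hle⟩, rfl⟩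
    have hpos : 0 < ‖γ 1 0‖ := norm_pos_iff.2 ((smul_infty_eq_coe_iff γ p).1 hp).1
    refine ⟨⟨p, rfl, γ, hγ, hp⟩, ?_⟩
    rw [CuspLine.exp_neg_depth hcusp hnorm (r := Quotient.mk (linkSetoid Γ) p) rfl hγ hp, mul_one_div]
    refine (CuspLine.ldist_le hz (r := Quotient.mk (linkSetoid Γ) p) rfl).trans ?_
    rwa [le_div_iff₀ (by positivity), dist_eq_norm]
  · rintro _ ⟨p₀, ⟨γ₀, hγ₀, hp₀, hle₀⟩, rfl⟩
    refine (finite_cusps hcusp ‖γ₀ 1 0‖ (‖z‖ + K)).subset ?_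
    rintro p ⟨⟨γ, hγ, hp, hle⟩, hpp⟩
    have hc := ((smul_infty_eq_coe_iff γ p).1 hp).1
    obtain ⟨δ, hδ, hδ0, hδp⟩ := CuspLine.HasEndpoint.exists_smul
      (ξ := Quotient.mk (linkSetoid Γ) p₀) (p := p₀) (q := p) rfl hpp
    refine ⟨γ, hγ, hp, (norm_lower_left_eq hcusp hγ₀ hγ hδ hδ0 (by rw [hp, hp₀, hδp])).le, ?_⟩
    have h1 : 1 ≤ ‖γ 1 0‖ ^ 2 := one_le_pow₀ (one_le_norm_of_isCuspNormalized hnorm hγ hc)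
    have h2 : ‖z - p‖ ≤ K := le_trans (le_mul_of_one_le_right (norm_nonneg _) h1) hle
    have h3 := norm_sub_norm_le p z
    rw [norm_sub_rev] at h3
    linarith

/-- The distance of lines is defined as an infimum, whence the slightly larger constant `K'`. -/
theorem CuspLine.finite_of_finite_approximants
    (hcusp : IsParabolicFixedPoint Γ (OnePoint.infty : OnePoint ℂ))
    (hnorm : IsCuspNormalized Γ) {ξ : CuspLine Γ} {z : ℂ} (hz : ξ.HasEndpoint z) {K K' : ℝ}
    (hK : K < K') (hfin : (approximants Γ z K').Finite) :
    {r : CuspLine Γ | r.IsRational ∧ ξ.ldist r ≤ K * Real.exp (-r.depth)}.Finite := by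
  refine (hfin.image (Quotient.mk (linkSetoid Γ))).subset ?_
  rintro r ⟨⟨p, hp, γ, hγ, hγp⟩, hle⟩
  obtain ⟨q, hq, hlt⟩ := CuspLine.exists_endpoint_of_ldist_lt hcusp hz
    (hle.trans_lt (mul_lt_mul_of_pos_right hK (Real.exp_pos _)))
  obtain ⟨δ, hδ, hδ0, hδp⟩ := hp.exists_smul hq
  have hδγ : (δ * γ) • (OnePoint.infty : OnePoint ℂ) = q := by rw [mul_smul, hγp, hδp]
  have hpos : 0 < ‖(δ * γ) 1 0‖ := norm_pos_iff.2 ((smul_infty_eq_coe_iff _ q).1 hδγ).1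
  refine ⟨q, ⟨δ * γ, Γ.mul_mem hδ hγ, hδγ, ?_⟩, hq⟩
  rw [CuspLine.exp_neg_depth hcusp hnorm hq (Γ.mul_mem hδ hγ) hδγ, mul_one_div,
    lt_div_iff₀ (by positivity), dist_eq_norm] at hlt
  exact hlt.le

end Discrete

/-! ### Lines asymptotic to the axis of a loxodromic element -/

namespace H3

theorem smul_t_le (g : SL(2, ℂ)) (hc : g 1 0 ≠ 0) (x : H3) :
    (g • x).t ≤ 1 / (‖g 1 0‖ ^ 2 * x.t) := by
  have hx := x.t_pos
  have hn : 0 < ‖g 1 0‖ := norm_pos_iff.2 hc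
  rw [smul_t, div_le_div_iff₀ (denom_pos g x) (by positivity), denom, Complex.normSq_eq_norm_sq,
    Complex.normSq_eq_norm_sq]
  nlinarith [sq_nonneg ‖g 1 0 * x.z + g 1 1‖]

theorem norm_smul_z_sub_le (g : SL(2, ℂ)) (hc : g 1 0 ≠ 0) (x : H3) :
    ‖(g • x).z - g 0 0 / g 1 0‖ ≤ 1 / (‖g 1 0‖ ^ 2 * x.t) := by
  have hx := x.t_pos
  have hn : 0 < ‖g 1 0‖ := norm_pos_iff.2 hc
  have hd := denom_pos g x
  have hd' : (denom g x : ℂ) ≠ 0 := by exact_mod_cast hd.ne'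
  have hD := H3.coe_denom g x
  have h1 : (g • x).z - g 0 0 / g 1 0
      = -star (g 1 0 * x.z + g 1 1) / (g 1 0 * denom g x) := by
    rw [smul_z, div_sub_div _ _ hd' hc, div_eq_div_iff (mul_ne_zero hd' hc) (mul_ne_zero hc hd')]
    rw [hD]
    linear_combination (-star (g 1 0 * x.z + g 1 1) * g 1 0 * ((g 1 0 * x.z + g 1 1) *
      star (g 1 0 * x.z + g 1 1) + g 1 0 * star (g 1 0) * x.t ^ 2)) * det_eq g
  rw [h1, norm_div, norm_neg, norm_star, norm_mul, Complex.norm_real, Real.norm_eq_abs,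
    abs_of_pos hd, div_le_div_iff₀ (by positivity) (by positivity), denom,
    Complex.normSq_eq_norm_sq, Complex.normSq_eq_norm_sq]
  set A := ‖g 1 0 * x.z + g 1 1‖
  have hA : 0 ≤ A := norm_nonneg _
  have h2 : A * (‖g 1 0‖ * x.t) ≤ A ^ 2 + ‖g 1 0‖ ^ 2 * x.t ^ 2 := by
    nlinarith [sq_nonneg (A - ‖g 1 0‖ * x.t), mul_nonneg hA (mul_nonneg hn.le hx.le)]
  nlinarith [mul_le_mul_of_nonneg_left h2 hn.le]

end H3

section Kleinian

variable {Γ : Subgroup SL(2, ℂ)}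

/-- The orbit of the base point under the powers of the loxodromic element converges to the
attracting fixed point. -/
theorem mem_limitSet_of_loxodromic {k : SL(2, ℂ)} {u : ℂˣ} (hu : 1 < ‖(u : ℂ)‖)
    (hmem : k * diag u * k⁻¹ ∈ Γ) (hc : k 1 0 ≠ 0) :
    ((k 0 0 / k 1 0 : ℂ) : OnePoint ℂ) ∈ limitSet Γ := by
  have hn : 0 < ‖k 1 0‖ := norm_pos_iff.2 hc
  set x : ℕ → H3 := fun n => diag (u ^ n) • k⁻¹ • H3.base with hx
  have hxt : Filter.Tendsto (fun n => (x n).t) Filter.atTop Filter.atTop := by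
    have h1 : ∀ n, (x n).t = (k⁻¹ • H3.base).t * (‖(u : ℂ)‖ ^ 2) ^ n := by
      intro n
      have hu0 : ‖(u : ℂ)‖ ≠ 0 := (one_pos.trans hu).ne'
      have hd : H3.denom (diag (u ^ n)) (k⁻¹ • H3.base) = ((‖(u : ℂ)‖ ^ 2) ^ n)⁻¹ := by
        rw [H3.denom, Complex.normSq_eq_norm_sq, Complex.normSq_eq_norm_sq, diag_one_zero,
          diag_one_one, Units.val_inv_eq_inv_val, Units.val_pow_eq_pow_val, zero_mul, zero_add,
          norm_zero, norm_inv, norm_pow, ← pow_mul, mul_comm 2 n, pow_mul]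
        simp
      rw [hx]
      simp only
      rw [H3.smul_t, hd, div_inv_eq_mul]
    simp only [h1]
    exact (tendsto_pow_atTop_atTop_of_one_lt (one_lt_pow₀ hu two_ne_zero)).const_mul_atTop
      (k⁻¹ • H3.base).t_pos
  have hb : Filter.Tendsto (fun n => 1 / (‖k 1 0‖ ^ 2 * (x n).t)) Filter.atTop (nhds 0) := by
    simp only [one_div]
    exact (hxt.const_mul_atTop (by positivity)).inv_tendsto_atTop
  have hz : Filter.Tendsto (fun n => (k • x n).z) Filter.atTop (nhds (k 0 0 / k 1 0)) :=
    tendsto_iff_norm_sub_tendsto_zero.2 (squeeze_zero (fun n => norm_nonneg _)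
      (fun n => H3.norm_smul_z_sub_le k hc (x n)) hb)
  have ht : Filter.Tendsto (fun n => (k • x n).t) Filter.atTop (nhds 0) :=
    squeeze_zero (fun n => (k • x n).t_pos.le) (fun n => H3.smul_t_le k hc (x n)) hb
  refine mem_closure_of_tendsto ((OnePoint.continuous_coe.tendsto _).comp (hz.prodMk_nhds ht))
    (Filter.Eventually.of_forall fun n => ⟨(k * diag u * k⁻¹) ^ n, Γ.pow_mem hmem n, ?_⟩)
  have h2 : (k * diag u * k⁻¹) ^ n = k * diag (u ^ n) * k⁻¹ := by
    rw [conj_pow, map_pow]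
  rw [h2, H3.mul_smul', H3.mul_smul']
  rfl

theorem isConicalLimitPoint_of_loxodromic {k : SL(2, ℂ)} {u : ℂˣ} (hu : 1 < ‖(u : ℂ)‖)
    (hmem : k * diag u * k⁻¹ ∈ Γ) (hc : k 1 0 ≠ 0) :
    IsConicalLimitPoint Γ ((k 0 0 / k 1 0 : ℂ) : OnePoint ℂ) := by
  refine ⟨mem_limitSet_of_loxodromic hu hmem hc, k, ?_, H3.hdist (k • H3.base) H3.base, ?_⟩
  · rw [smul_infty_eq, if_neg hc]
  · rw [Filter.frequently_atTop]
    intro s₀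
    have hlog : 0 < 2 * Real.log ‖(u : ℂ)‖ := mul_pos two_pos (Real.log_pos hu)
    obtain ⟨n, hn⟩ := exists_nat_ge (s₀ / (2 * Real.log ‖(u : ℂ)‖))
    rw [div_le_iff₀ hlog] at hn
    refine ⟨n * (2 * Real.log ‖(u : ℂ)‖), hn, (k * diag u * k⁻¹) ^ (-n : ℤ),
      Γ.zpow_mem hmem _, ?_⟩
    have hu0 : 0 < ‖(u : ℂ)‖ := one_pos.trans hu
    have h1 : (k * diag u * k⁻¹) ^ (-n : ℤ) * k = k * diag (u ^ (-n : ℤ)) := by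
      rw [conj_diag_zpow]
      group
    rw [← H3.mul_smul', h1, H3.mul_smul', H3.diag_smul_onAxis]
    refine le_of_eq ?_
    congr 2
    refine H3.ext rfl ?_
    simp only [H3.onAxis, H3.base]
    have h2 : Real.exp (n * (2 * Real.log ‖(u : ℂ)‖)) = (‖(u : ℂ)‖ ^ n) ^ 2 := by
      rw [← pow_mul, ← Real.exp_log hu0, ← Real.exp_nat_mul, Real.log_exp]
      congr 1
      push_cast
      ring
    rw [h2, zpow_neg, zpow_natCast, Units.val_inv_eq_inv_val, Units.val_pow_eq_pow_val, norm_inv,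
      norm_pow, inv_pow, inv_mul_cancel₀ (by positivity)]

/-- If no translate of the axis of `k * diag u * k⁻¹` is higher than `1 / (2 κ)`, the attracting
fixed point `k 0 0 / k 1 0` of this element is badly approximated by the orbit of the cusp. -/
theorem finite_approximants_of_le [DiscreteTopology Γ]
    (hcusp : IsParabolicFixedPoint Γ (OnePoint.infty : OnePoint ℂ)) (hnorm : IsCuspNormalized Γ)
    {k : SL(2, ℂ)} (hc : k 1 0 ≠ 0) {κ K : ℝ}
    (hκ : ∀ δ ∈ Γ, κ ≤ ‖(δ * k) 1 0‖ * ‖(δ * k) 1 1‖) (hK0 : 0 < K) (hK : K < κ) :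
    (approximants Γ (k 0 0 / k 1 0) K).Finite := by
  have hn : 0 < ‖k 1 0‖ := norm_pos_iff.2 hc
  set ξ := k 0 0 / k 1 0 with hξ
  set E := ‖k 1 0‖ * ‖k 1 1‖ with hE
  refine (finite_cusps hcusp (K ^ 2 * E / (κ - K)) (‖ξ‖ + K)).subset ?_
  rintro p ⟨γ, hγ, hp, hle⟩
  obtain ⟨hc', ha⟩ := (smul_infty_eq_coe_iff γ p).1 hp
  have h1 := one_le_norm_of_isCuspNormalized hnorm hγ hc'
  have h1' : 1 ≤ ‖γ 1 0‖ ^ 2 := one_le_pow₀ h1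
  have hκγ := hκ γ⁻¹ (Γ.inv_mem hγ)
  have hk00 : k 0 0 = ξ * k 1 0 := by rw [hξ]; field_simp
  have e0 : (γ⁻¹ * k) 1 0 = γ 1 0 * k 1 0 * (p - ξ) := by
    rw [mul_apply, inv_apply_one_zero, inv_apply_one_one, ha, hk00]
    ring
  have e1 : (γ⁻¹ * k) 1 1 * k 1 0 = γ 1 0 * (1 + k 1 0 * k 1 1 * (p - ξ)) := by
    have hdet := det_eq k
    rw [mul_apply, inv_apply_one_zero, inv_apply_one_one, ha]
    rw [hk00] at hdet
    linear_combination γ 1 0 * hdet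
  set D := ‖ξ - p‖ with hD
  have hD0 : 0 ≤ D := norm_nonneg _
  have h2 : ‖(γ⁻¹ * k) 1 0‖ * ‖(γ⁻¹ * k) 1 1‖ ≤ D * ‖γ 1 0‖ ^ 2 * (1 + E * D) := by
    have h3 : ‖(γ⁻¹ * k) 1 1‖ * ‖k 1 0‖ ≤ ‖γ 1 0‖ * (1 + E * D) := by
      rw [← norm_mul, e1, norm_mul]
      gcongr
      refine (norm_add_le _ _).trans ?_
      rw [norm_one, norm_mul, norm_mul, norm_sub_rev]
    calc ‖(γ⁻¹ * k) 1 0‖ * ‖(γ⁻¹ * k) 1 1‖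
        = ‖γ 1 0‖ * D * (‖(γ⁻¹ * k) 1 1‖ * ‖k 1 0‖) := by
          rw [e0, norm_mul, norm_mul, norm_sub_rev p ξ]
          ring
      _ ≤ ‖γ 1 0‖ * D * (‖γ 1 0‖ * (1 + E * D)) := by gcongr
      _ = D * ‖γ 1 0‖ ^ 2 * (1 + E * D) := by ring
  have hE0 : 0 ≤ E := by positivity
  have h4 : κ ≤ K * (1 + E * D) := by
    refine (hκγ.trans h2).trans ?_
    gcongr
  refine ⟨γ, hγ, hp, ?_, ?_⟩
  · rw [le_div_iff₀ (sub_pos.2 hK)]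
    calc ‖γ 1 0‖ * (κ - K) ≤ ‖γ 1 0‖ ^ 2 * (κ - K) := by
          refine mul_le_mul_of_nonneg_right ?_ (sub_nonneg.2 hK.le)
          nlinarith
      _ ≤ ‖γ 1 0‖ ^ 2 * (K * E * D) := by
          gcongr
          linarith
      _ = K * E * (D * ‖γ 1 0‖ ^ 2) := by ring
      _ ≤ K * E * K := by gcongr
      _ = K ^ 2 * E := by ring
  · have h5 : D ≤ K := le_trans (le_mul_of_one_le_right hD0 h1') hle
    have h6 := norm_sub_norm_le p ξ
    rw [norm_sub_rev] at h6
    linarith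

end Kleinian

/-! ### Closing almost closed geodesics -/

/-- The choice of the square root that avoids cancellation. -/
theorem exists_sq_eq_norm_le (e D : ℂ) : ∃ s : ℂ, s ^ 2 = D ∧ ‖e‖ ≤ ‖e + s‖ := by
  obtain ⟨s, hs⟩ := IsAlgClosed.exists_pow_nat_eq D two_pos
  by_cases h : ‖e‖ ≤ ‖e + s‖
  · exact ⟨s, hs, h⟩
  · refine ⟨-s, by rw [neg_sq, hs], ?_⟩
    have h1 := norm_add_le (e + s) (e + -s)
    have h2 : e + s + (e + -s) = 2 * e := by ring
    rw [h2, norm_mul, Complex.norm_two] at h1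
    linarith

/-- A matrix close to `diag μ μ⁻¹`, in the sense that it is the product of the latter with a matrix
close to `1`, is loxodromic, with an axis close to the one of `diag μ μ⁻¹` along a fundamental
segment. The closeness is stated dually, on row vectors: `(x', y')` are the coordinates of `(x, y)`
in the basis of eigenvectors, and the first two hypotheses on them say that the point of the axis
where this pair is balanced lies in this segment. -/
theorem exists_eigenframe {ε μ : ℝ} (hε0 : 0 < ε) (hε : ε ≤ 1 / 16) (hμ : 3 ≤ μ) {B : SL(2, ℂ)}
    (h00 : ‖B 0 0 - μ‖ ≤ ε * μ) (h01 : ‖B 0 1‖ ≤ ε * μ) (h10 : ‖B 1 0‖ ≤ ε / μ)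
    (h11 : ‖B 1 1 - (μ : ℂ)⁻¹‖ ≤ ε / μ) :
    ∃ (q : SL(2, ℂ)) (u : ℂˣ), 1 < ‖(u : ℂ)‖ ∧ B = q * diag u * q⁻¹ ∧
      ∀ x y x' y' : ℂ, x' = x * q 0 0 + y * q 1 0 → y' = x * q 0 1 + y * q 1 1 →
        ‖x'‖ ≤ ‖y'‖ → ‖y'‖ ≤ ‖(u : ℂ)‖ ^ 2 * ‖x'‖ →
        ‖x‖ * ‖y‖ ≤ (1 + 16 * ε) ^ 2 * (‖x'‖ * ‖y'‖) ∧ ‖x‖ ≤ 8 * ‖y‖ := by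
  have hdet := det_eq B
  set a := B 0 0
  set b := B 0 1
  set c := B 1 0
  set d := B 1 1
  have hμ0 : 0 < μ := by linarith
  have nμ : ‖(μ : ℂ)‖ = μ := by rw [Complex.norm_real, Real.norm_eq_abs, abs_of_pos hμ0]
  have hεμ : ε / μ ≤ 1 / 48 := by
    rw [div_le_iff₀ hμ0]
    linarith
  have hμinv : μ⁻¹ ≤ 1 / 3 := by
    rw [one_div]
    exact inv_anti₀ (by norm_num) hμ
  obtain ⟨s, hs, hes⟩ := exists_sq_eq_norm_le (a - d) ((a - d) ^ 2 + 4 * b * c)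
  have he : μ / 2 ≤ ‖a - d‖ := by
    have h1 : (μ : ℂ) = (a - d) - (a - μ) + (d - (μ : ℂ)⁻¹) + (μ : ℂ)⁻¹ := by ring
    have h2 : μ ≤ ‖a - d‖ + ‖a - μ‖ + ‖d - (μ : ℂ)⁻¹‖ + ‖(μ : ℂ)⁻¹‖ := by
      conv_lhs => rw [← nμ, h1]
      refine (norm_add_le _ _).trans (add_le_add_left ((norm_add_le _ _).trans
        (add_le_add_left (norm_sub_le _ _) _)) _)
    rw [norm_inv, nμ] at h2
    have h3 : ε * μ ≤ 1 / 16 * μ := by gcongr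
    linarith
  have hes' : μ / 2 ≤ ‖a - d + s‖ := he.trans hes
  have hne : a - d + s ≠ 0 := by
    rw [← norm_pos_iff]
    linarith
  -- slopes of the eigenvectors `(1, ζ)` and `(η, 1)`
  set ζ := 2 * c / (a - d + s) with hζ
  set η := -(2 * b) / (a - d + s) with hη
  have eζ : c + d * ζ = (a + b * ζ) * ζ := by
    rw [hζ]
    field_simp
    linear_combination c * hs
  have eη : a * η + b = (c * η + d) * η := by
    rw [hη]
    field_simp
    linear_combination b * hs
  have nζ : ‖ζ‖ ≤ 4 * ε / μ ^ 2 := by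
    rw [hζ, norm_div, norm_mul, Complex.norm_two]
    calc 2 * ‖c‖ / ‖a - d + s‖ ≤ 2 * (ε / μ) / (μ / 2) := by gcongr
      _ = 4 * ε / μ ^ 2 := by
        field_simp
        ring
  have nη : ‖η‖ ≤ 4 * ε := by
    rw [hη, norm_div, norm_neg, norm_mul, Complex.norm_two]
    calc 2 * ‖b‖ / ‖a - d + s‖ ≤ 2 * (ε * μ) / (μ / 2) := by gcongr
      _ = 4 * ε := by
        field_simp
        ring
  have nζ' : ‖ζ‖ ≤ ε := by
    refine nζ.trans ?_
    rw [div_le_iff₀ (by positivity)]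
    have h9 : 9 ≤ μ ^ 2 := by nlinarith
    have := mul_le_mul_of_nonneg_left h9 hε0.le
    linarith
  obtain ⟨w, hw⟩ : ∃ w, w = 1 - η * ζ := ⟨_, rfl⟩
  have hw1 : ‖1 - w‖ ≤ ε / 4 := by
    rw [hw, sub_sub_cancel, norm_mul]
    calc ‖η‖ * ‖ζ‖ ≤ 4 * ε * ε := by gcongr
      _ ≤ ε / 4 := by nlinarith
  have hwge : 1 - ε / 4 ≤ ‖w‖ := by
    have := norm_sub_norm_le (1 : ℂ) (1 - w)
    rw [sub_sub_cancel, norm_one] at this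
    linarith
  have hwle : ‖w‖ ≤ 1 + ε / 4 := by
    have := norm_sub_norm_le w (1 : ℂ)
    rw [norm_sub_rev, norm_one] at this
    linarith
  have hwpos : 0 < ‖w‖ := by linarith
  have hw0 : w ≠ 0 := norm_pos_iff.1 hwpos
  have hwinv : ‖w‖⁻¹ ≤ 1 + ε := by
    rw [inv_le_comm₀ hwpos (by linarith)]
    refine le_trans ?_ hwge
    rw [inv_le_iff_one_le_mul₀ (by linarith)]
    nlinarith
  have hwinv' : 3 / 4 ≤ ‖w‖⁻¹ := by
    rw [le_inv_comm₀ (by norm_num) hwpos]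
    refine hwle.trans ?_
    norm_num
    linarith
  have hnu : ‖a + b * ζ - μ‖ ≤ μ / 8 := by
    have h1 : a + b * ζ - μ = (a - μ) + b * ζ := by ring
    rw [h1]
    refine (norm_add_le _ _).trans ?_
    rw [norm_mul]
    have h2 : ‖b‖ * ‖ζ‖ ≤ ε * μ * ε := by gcongr
    have h3 : ε * μ ≤ 1 / 16 * μ := by gcongr
    have h4 : ε * μ * ε ≤ ε * μ * 1 := by gcongr; linarith
    linarith
  have hu1 : 1 < ‖a + b * ζ‖ := by
    have := norm_sub_norm_le (μ : ℂ) (μ - (a + b * ζ))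
    rw [sub_sub_cancel, nμ, norm_sub_rev] at this
    linarith
  have hu2 : ‖a + b * ζ‖ ^ 2 ≤ 2 * μ ^ 2 := by
    have := norm_sub_norm_le (a + b * ζ) μ
    rw [nμ] at this
    have h2 : ‖a + b * ζ‖ ≤ 9 / 8 * μ := by linarith
    calc ‖a + b * ζ‖ ^ 2 ≤ (9 / 8 * μ) ^ 2 := by gcongr
      _ ≤ 2 * μ ^ 2 := by nlinarith
  have huu : (a + b * ζ) * (c * η + d) = 1 := by
    have h1 : (a + b * ζ) * (c * η + d) * w = 1 * w := by
      rw [hw]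
      linear_combination (1 - ζ * η) * hdet + (c * η + d) * η * eζ + (c + d * ζ) * eη
    exact mul_right_cancel₀ hw0 h1
  have hu0 : a + b * ζ ≠ 0 := left_ne_zero_of_mul_eq_one huu
  have huinv : (a + b * ζ)⁻¹ = c * η + d := inv_eq_of_mul_eq_one_right huu
  set q : SL(2, ℂ) := ⟨!![w⁻¹, η; ζ * w⁻¹, 1], by
    rw [Matrix.det_fin_two_of]
    field_simp
    rw [hw]⟩ with hq
  have q00 : q 0 0 = w⁻¹ := rfl
  have q01 : q 0 1 = η := rfl
  have q10 : q 1 0 = ζ * w⁻¹ := rfl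
  have q11 : q 1 1 = 1 := rfl
  refine ⟨q, Units.mk0 _ hu0, hu1, ?_, ?_⟩
  · rw [eq_mul_inv_iff_mul_eq]
    apply ext_entries
    · rw [mul_apply, mul_diag_apply_zero, q00, q10, Units.val_mk0]
      ring
    · rw [mul_apply, mul_diag_apply_one, q01, q11, Units.val_mk0, huinv]
      linear_combination eη
    · rw [mul_apply, mul_diag_apply_zero, q00, q10, Units.val_mk0]
      linear_combination w⁻¹ * eζ
    · rw [mul_apply, mul_diag_apply_one, q01, q11, Units.val_mk0, huinv]
      ring
  · intro x y x' y' hx' hy' hle hge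
    rw [Units.val_mk0] at hge
    rw [q00, q10] at hx'
    rw [q01, q11] at hy'
    have hx : x = x' - y' * (ζ * w⁻¹) := by
      rw [hx', hy']
      field_simp
      rw [hw]
      ring
    have hy : y = y' * w⁻¹ - x' * η := by
      rw [hx', hy']
      field_simp
      rw [hw]
      ring
    have n1 := norm_nonneg x'
    have n2 := norm_nonneg y'
    have bx : ‖x‖ ≤ (1 + 16 * ε) * ‖x'‖ := by
      have h1 : ‖y'‖ * (‖ζ‖ * ‖w‖⁻¹) ≤ 16 * ε * ‖x'‖ :=
        calc ‖y'‖ * (‖ζ‖ * ‖w‖⁻¹) ≤ (2 * μ ^ 2 * ‖x'‖) * (4 * ε / μ ^ 2 * 2) := by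
              gcongr
              · exact hge.trans (by gcongr)
              · linarith
          _ = 16 * ε * ‖x'‖ := by
            field_simp
            ring
      rw [hx]
      refine (norm_sub_le _ _).trans ?_
      rw [norm_mul, norm_mul, norm_inv]
      linarith
    have bη : ‖x'‖ * ‖η‖ ≤ ‖y'‖ * (4 * ε) := by gcongr
    have by1 : ‖y‖ ≤ (1 + 16 * ε) * ‖y'‖ := by
      rw [hy]
      refine (norm_sub_le _ _).trans ?_
      rw [norm_mul, norm_mul, norm_inv]
      have h1 : ‖y'‖ * ‖w‖⁻¹ ≤ ‖y'‖ * (1 + ε) := by gcongr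
      nlinarith
    have by2 : ‖y'‖ / 2 ≤ ‖y‖ := by
      rw [hy]
      refine le_trans ?_ (norm_sub_norm_le _ _)
      rw [norm_mul, norm_mul, norm_inv]
      have h1 : ‖y'‖ * (3 / 4) ≤ ‖y'‖ * ‖w‖⁻¹ := by gcongr
      nlinarith
    constructor
    · calc ‖x‖ * ‖y‖ ≤ ((1 + 16 * ε) * ‖x'‖) * ((1 + 16 * ε) * ‖y'‖) := by gcongr
        _ = (1 + 16 * ε) ^ 2 * (‖x'‖ * ‖y'‖) := by ring
    · have h1 : (1 + 16 * ε) * ‖x'‖ ≤ 2 * ‖x'‖ := by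
        refine mul_le_mul_of_nonneg_right ?_ n1
        linarith
      linarith [norm_nonneg y]

/-- The parameter for which `diag (expHalf s)` is the translation of length `s` along the vertical
axis. -/
noncomputable def expHalf (s : ℝ) : ℂˣ :=
  Units.mk0 ((Real.exp (s / 2) : ℝ) : ℂ) (by exact_mod_cast (Real.exp_pos _).ne')

theorem coe_expHalf (s : ℝ) : (expHalf s : ℂ) = (Real.exp (s / 2) : ℝ) := rfl

theorem norm_expHalf (s : ℝ) : ‖(expHalf s : ℂ)‖ = Real.exp (s / 2) := by
  rw [coe_expHalf, Complex.norm_real, Real.norm_eq_abs, abs_of_pos (Real.exp_pos _)]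

theorem inv_expHalf_mul (s t : ℝ) : (expHalf s)⁻¹ * expHalf t = expHalf (t - s) := by
  ext
  rw [Units.val_mul, Units.val_inv_eq_inv_val, coe_expHalf, coe_expHalf, coe_expHalf,
    ← Complex.ofReal_inv, ← Complex.ofReal_mul, ← Real.exp_neg, ← Real.exp_add]
  congr 2
  ring

theorem diag_expHalf_smul_base (s : ℝ) :
    diag (expHalf s) • H3.base = H3.onAxis (Real.exp s) (Real.exp_pos s) := by
  rw [H3.base, H3.diag_smul_onAxis]
  refine H3.ext rfl ?_
  simp only [H3.onAxis]
  rw [norm_expHalf, mul_one, sq, ← Real.exp_add, add_halves]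

section Kleinian

variable {Γ : Subgroup SL(2, ℂ)}

/-- At a conical limit point, the vertical line recurs to a bounded region: here `g` maps the
vertical line above `0` to the one above `ξ`. -/
theorem IsConicalLimitPoint.exists_frame {ξ : ℂ} (h : IsConicalLimitPoint Γ ξ) :
    ∃ g : SL(2, ℂ), g 1 0 ≠ 0 ∧ g 0 0 = ξ * g 1 0 ∧ g 1 1 = 0 ∧ ∃ C : ℝ, ∃ᶠ s : ℝ in Filter.atTop,
      ∃ γ ∈ Γ, ∀ i j, ‖(γ * g * diag (expHalf s)) i j‖ ≤ C := by
  obtain ⟨-, g, hg, R, hR⟩ := h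
  obtain ⟨hc, ha⟩ := (smul_infty_eq_coe_iff g ξ).1 hg
  set b := -g 1 1 / g 1 0 with hb
  -- a unipotent correction moves the other endpoint of the line to `∞`; along the ray to `ξ`, the
  -- corrected frames remain at a bounded distance from the original ones
  set n : SL(2, ℂ) := ⟨!![1, b; 0, 1], by rw [Matrix.det_fin_two_of]; ring⟩
  have n00 : n 0 0 = 1 := rfl
  have n01 : n 0 1 = b := rfl
  have n10 : n 1 0 = 0 := rfl
  have n11 : n 1 1 = 1 := rfl
  set C := √(4 * Real.sinh (R / 2) ^ 2 + 2) with hC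
  have hC0 : 0 ≤ C := Real.sqrt_nonneg _
  refine ⟨g * n, ?_, ?_, ?_, C * ‖b‖ + C, ?_⟩
  · rwa [mul_apply, n00, n10, mul_one, mul_zero, add_zero]
  · rw [mul_apply, mul_apply, n00, n10, mul_one, mul_zero, add_zero, mul_one, mul_zero, add_zero,
      ha]
  · rw [mul_apply, n01, n11, hb]
    field_simp
    ring
  · refine (hR.and_eventually (Filter.eventually_ge_atTop 0)).mono ?_
    rintro s ⟨⟨γ, hγ, hle⟩, hs⟩
    refine ⟨γ, hγ, ?_⟩
    rw [← diag_expHalf_smul_base, ← H3.mul_smul', ← H3.mul_smul'] at hle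
    have hsum := H3.sum_norm_sq_le _ _ hle
    have hbd : ∀ i j, ‖(γ * g * diag (expHalf s)) i j‖ ≤ C := by
      intro i j
      refine Real.le_sqrt_of_sq_le (le_trans ?_ hsum)
      have q0 := sq_nonneg ‖(γ * g * diag (expHalf s)) 0 0‖
      have q1 := sq_nonneg ‖(γ * g * diag (expHalf s)) 0 1‖
      have q2 := sq_nonneg ‖(γ * g * diag (expHalf s)) 1 0‖
      have q3 := sq_nonneg ‖(γ * g * diag (expHalf s)) 1 1‖
      fin_cases i <;> fin_cases j <;> simp only [Fin.zero_eta, Fin.mk_one, Fin.isValue] <;>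
        linarith
    have he : 1 ≤ Real.exp (s / 2) := Real.one_le_exp (by linarith)
    have e0 : ∀ i, (γ * (g * n) * diag (expHalf s)) i 0 = (γ * g * diag (expHalf s)) i 0 := by
      intro i
      rw [← mul_assoc, mul_diag_apply_zero, mul_diag_apply_zero, mul_apply _ n, n00, n10]
      ring
    have e1 : ∀ i, (γ * (g * n) * diag (expHalf s)) i 1 =
        (γ * g * diag (expHalf s)) i 0 * (b * ((expHalf s : ℂ)⁻¹ * (expHalf s : ℂ)⁻¹))
          + (γ * g * diag (expHalf s)) i 1 := by
      intro i
      have := (expHalf s).ne_zero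
      rw [← mul_assoc, mul_diag_apply_one, mul_diag_apply_zero, mul_diag_apply_one,
        mul_apply _ n, n01, n11]
      field_simp
    have hCb : 0 ≤ C * ‖b‖ := by positivity
    intro i j
    fin_cases j <;> simp only [Fin.zero_eta, Fin.mk_one, Fin.isValue]
    · rw [e0]
      linarith [hbd i 0]
    · rw [e1]
      refine (norm_add_le _ _).trans (add_le_add ?_ (hbd i 1))
      rw [norm_mul, norm_mul, norm_mul, norm_inv, norm_expHalf]
      have h1 : (Real.exp (s / 2))⁻¹ ≤ 1 := inv_le_one_of_one_le₀ he
      have h2 : (Real.exp (s / 2))⁻¹ * (Real.exp (s / 2))⁻¹ ≤ 1 :=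
        mul_le_one₀ h1 (by positivity) h1
      exact mul_le_mul (hbd i 0) (mul_le_of_le_one_right (norm_nonneg _) h2) (by positivity) hC0

/-- Among bounded frames along a line, there are two far away along the line, far from each other
and almost equal. -/
theorem exists_close_pair {C : ℝ} {h : ℕ → SL(2, ℂ)} (hC : ∀ n i j, ‖h n i j‖ ≤ C) {s : ℕ → ℝ}
    (hs : Filter.Tendsto s Filter.atTop Filter.atTop) {ε : ℝ} (hε : 0 < ε) (S L : ℝ) :
    ∃ n m, S ≤ s n ∧ s n + L ≤ s m ∧
      ∀ i j, ‖((h m)⁻¹ * h n) i j - (1 : SL(2, ℂ)) i j‖ ≤ ε := by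
  have : FirstCountableTopology (Matrix (Fin 2) (Fin 2) ℂ) :=
    inferInstanceAs (FirstCountableTopology (Fin 2 → Fin 2 → ℂ))
  have : FirstCountableTopology SL(2, ℂ) :=
    (Matrix.SpecialLinearGroup.isClosedEmbedding_val (n := Fin 2)
      (R := ℂ)).isInducing.firstCountableTopology
  obtain ⟨l, -, φ, hφ, hl⟩ := (isCompact_setOf_norm_le C).tendsto_subseq hC
  have h1 : Filter.Tendsto (fun p : ℕ × ℕ => (h (φ p.1))⁻¹ * h (φ p.2))
      (Filter.atTop ×ˢ Filter.atTop) (nhds 1) := by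
    have := (hl.comp Filter.tendsto_fst (f := Prod.fst)
      (x := Filter.atTop ×ˢ (Filter.atTop : Filter ℕ))).inv.mul
      (hl.comp (Filter.tendsto_snd (f := (Filter.atTop : Filter ℕ))))
    rwa [inv_mul_cancel] at this
  have h2 : ∀ᶠ p : ℕ × ℕ in Filter.atTop ×ˢ Filter.atTop,
      ∀ i j, ‖((h (φ p.1))⁻¹ * h (φ p.2)) i j - (1 : SL(2, ℂ)) i j‖ ≤ ε := by
    rw [Filter.eventually_all]
    intro i
    rw [Filter.eventually_all]
    intro j
    have hcont : Continuous fun g : SL(2, ℂ) => ‖g i j - (1 : SL(2, ℂ)) i j‖ := by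
      refine ((?_ : Continuous fun g : SL(2, ℂ) => g i j).sub continuous_const).norm
      exact (continuous_apply j).comp ((continuous_apply i).comp continuous_subtype_val)
    have h3 := (hcont.tendsto 1).comp h1
    rw [sub_self, norm_zero] at h3
    exact h3.eventually (eventually_le_nhds hε)
  rw [Filter.prod_atTop_atTop_eq, Filter.eventually_atTop_prod_self'] at h2
  obtain ⟨N, hN⟩ := h2
  have hsφ := hs.comp hφ.tendsto_atTop
  obtain ⟨n, hn1, hn2⟩ := ((hsφ.eventually_ge_atTop S).and
    (Filter.eventually_ge_atTop N)).exists
  obtain ⟨m, hm1, hm2⟩ := ((hsφ.eventually_ge_atTop (s (φ n) + L)).and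
    (Filter.eventually_ge_atTop N)).exists
  exact ⟨φ n, φ m, hn1, hm1, hN m hm2 n hn2⟩

end Kleinian

/-- The closing argument: if only finitely many orbit points of the cusp approximate the irrational
point `ξ` with the constant `K`, then for every `κ < K` there is a loxodromic element of `Γ`, no
translate of whose axis is higher than `1 / (2 κ)`. -/
theorem exists_loxodromic_of_finite_approximants {Γ : Subgroup SL(2, ℂ)} [DiscreteTopology Γ]
    (hcusp : IsParabolicFixedPoint Γ (OnePoint.infty : OnePoint ℂ)) {ξ : ℂ}
    (hcon : IsConicalLimitPoint Γ ξ) (hpar : ¬ IsParabolicFixedPoint Γ (ξ : OnePoint ℂ))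
    {κ K : ℝ} (hκ0 : 0 < κ) (hκ : κ < K) (hfin : (approximants Γ ξ K).Finite) :
    ∃ (k : SL(2, ℂ)) (u : ℂˣ), 1 < ‖(u : ℂ)‖ ∧ k * diag u * k⁻¹ ∈ Γ ∧
      ∀ δ ∈ Γ, κ ≤ ‖(δ * k) 1 0‖ * ‖(δ * k) 1 1‖ := by
  have hξ : ξ ∉ approximants Γ ξ K := by
    rintro ⟨γ, hγ, hγξ, -⟩
    obtain ⟨T, hT, hTpar, hTfix⟩ := hcusp
    refine hpar ⟨γ * T * γ⁻¹, Γ.mul_mem (Γ.mul_mem hγ hT) (Γ.inv_mem hγ), ?_, ?_⟩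
    · have h : (Matrix.SpecialLinearGroup.toGL γ * Matrix.SpecialLinearGroup.toGL T *
          (Matrix.SpecialLinearGroup.toGL γ)⁻¹).IsParabolic :=
        (Matrix.GeneralLinearGroup.isParabolic_conj_iff _ _).2 hTpar
      rw [← map_inv, ← map_mul, ← map_mul] at h
      exact h
    · rw [← hγξ, mul_smul, mul_smul, inv_smul_smul, hTfix]
  obtain ⟨ρ, hρ, hball⟩ := Metric.isOpen_iff.1 hfin.isClosed.isOpen_compl ξ hξ
  obtain ⟨g, hg10, hg00, hg11, C, hfreq⟩ := hcon.exists_frame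
  have hgdet : g 0 1 * g 1 0 = -1 := by
    have := det_eq g
    rw [hg11] at this
    linear_combination -this
  have hτ : 0 < ‖g 1 0‖ := norm_pos_iff.2 hg10
  choose s hs γ hγ hbd using fun n : ℕ => Filter.frequently_atTop.1 hfreq n
  -- the precision `ε` is such that `(1 + 16 ε) ^ 2 κ ≤ K`
  set ε := min (1 / 16) ((K - κ) / (48 * κ)) with hε
  have hε0 : 0 < ε := lt_min (by norm_num) (div_pos (sub_pos.2 hκ) (by positivity))
  have hε16 : ε ≤ 1 / 16 := min_le_left _ _
  have hεK : (1 + 16 * ε) ^ 2 * κ ≤ K := by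
    have h1 : ε * (48 * κ) ≤ K - κ := (le_div_iff₀ (by positivity)).1 (min_le_right _ _)
    have h2 : (1 + 16 * ε) ^ 2 ≤ 1 + 48 * ε := by nlinarith
    nlinarith [mul_le_mul_of_nonneg_right h2 hκ0.le]
  -- beyond height `S`, the horoballs at the exceptional orbit points do not matter any more
  obtain ⟨S, hS⟩ : ∃ S : ℝ, ∀ t, S ≤ t → 8 < ‖g 1 0‖ ^ 2 * ρ * Real.exp t := by
    have h1 : Filter.Tendsto (fun t => ‖g 1 0‖ ^ 2 * ρ * Real.exp t) Filter.atTop Filter.atTop :=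
      Real.tendsto_exp_atTop.const_mul_atTop (by positivity)
    exact Filter.eventually_atTop.1 (h1.eventually_gt_atTop 8)
  obtain ⟨n, m, hSn, hnm, hclose⟩ := exists_close_pair
    (h := fun n => γ n * g * diag (expHalf (s n))) hbd
    (Filter.tendsto_atTop_mono hs tendsto_natCast_atTop_atTop) hε0 S 4
  set w := (γ m * g * diag (expHalf (s m)))⁻¹ * (γ n * g * diag (expHalf (s n))) with hw
  set f := g * diag (expHalf (s n)) with hf
  set μ := Real.exp ((s m - s n) / 2) with hμ
  have hμ3 : 3 ≤ μ := by
    have := Real.add_one_le_exp ((s m - s n) / 2)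
    linarith
  have hμ0 : 0 < μ := Real.exp_pos _
  set B := diag (expHalf (s m - s n)) * w with hB
  have hσ : (γ m)⁻¹ * γ n = f * B * f⁻¹ := by
    rw [hB, hw, hf, ← inv_expHalf_mul, map_mul, map_inv]
    group
  have B0 : ∀ j, B 0 j = μ * w 0 j := by
    intro j
    rw [hB, mul_apply, diag_zero_zero, diag_zero_one, coe_expHalf, zero_mul, add_zero]
  have B1 : ∀ j, B 1 j = (μ : ℂ)⁻¹ * w 1 j := by
    intro j
    rw [hB, mul_apply, diag_one_zero, diag_one_one, Units.val_inv_eq_inv_val, coe_expHalf,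
      zero_mul, zero_add]
  have nμ : ‖(μ : ℂ)‖ = μ := by rw [Complex.norm_real, Real.norm_eq_abs, abs_of_pos hμ0]
  have c00 : ‖w 0 0 - 1‖ ≤ ε := hclose 0 0
  have c01 : ‖w 0 1‖ ≤ ε := by simpa using hclose 0 1
  have c10 : ‖w 1 0‖ ≤ ε := by simpa using hclose 1 0
  have c11 : ‖w 1 1 - 1‖ ≤ ε := hclose 1 1
  obtain ⟨q, u, hu, hBq, hq⟩ := exists_eigenframe (B := B) hε0 hε16 hμ3
    (by
      have : B 0 0 - μ = μ * (w 0 0 - 1) := by rw [B0]; ring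
      rw [this, norm_mul, nμ, mul_comm]
      gcongr)
    (by
      rw [B0, norm_mul, nμ, mul_comm]
      gcongr)
    (by
      rw [B1, norm_mul, norm_inv, nμ, mul_comm, div_eq_mul_inv]
      gcongr)
    (by
      have : B 1 1 - (μ : ℂ)⁻¹ = (μ : ℂ)⁻¹ * (w 1 1 - 1) := by rw [B1]; ring
      rw [this, norm_mul, norm_inv, nμ, mul_comm, div_eq_mul_inv]
      gcongr)
  have hmem : f * q * diag u * (f * q)⁻¹ ∈ Γ := by
    have h1 : f * q * diag u * (f * q)⁻¹ = (γ m)⁻¹ * γ n := by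
      rw [hσ, hBq]
      group
    rw [h1]
    exact Γ.mul_mem (Γ.inv_mem (hγ m)) (hγ n)
  refine ⟨f * q, u, hu, hmem, fun δ₀ hδ₀ => ?_⟩
  by_contra! hlt
  obtain ⟨δ, hδ, heq, hle, hge⟩ := exists_balanced hcusp hu hmem hδ₀
  rw [← heq] at hlt
  rw [← mul_assoc] at hlt hle hge
  obtain ⟨hxy, hx8⟩ := hq ((δ * f) 1 0) ((δ * f) 1 1) _ _ (mul_apply _ _ 1 0) (mul_apply _ _ 1 1)
    hle hge
  have hxyK : ‖(δ * f) 1 0‖ * ‖(δ * f) 1 1‖ ≤ K := by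
    refine (hxy.trans ?_).trans hεK
    gcongr
  set a := Real.exp (s n / 2) with ha
  have ha0 : 0 < a := Real.exp_pos _
  have haa : a ^ 2 = Real.exp (s n) := by rw [sq, ← Real.exp_add, add_halves]
  have ex : (δ * f) 1 0 = (δ 1 0 * ξ + δ 1 1) * g 1 0 * a := by
    rw [hf, ← mul_assoc, mul_diag_apply_zero, mul_apply, hg00, coe_expHalf]
    ring
  have ey : (δ * f) 1 1 = δ 1 0 * g 0 1 * (a : ℂ)⁻¹ := by
    rw [hf, ← mul_assoc, mul_diag_apply_one, mul_apply, hg11, coe_expHalf]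
    ring
  have na : ‖(a : ℂ)‖ = a := by rw [Complex.norm_real, Real.norm_eq_abs, abs_of_pos ha0]
  have hδ10 : δ 1 0 ≠ 0 := by
    intro h0
    have h1 : (δ * f) 1 1 = 0 := by rw [ey, h0, zero_mul, zero_mul]
    rw [h1, norm_zero, mul_zero] at hx8
    exact bottom_row_ne_zero (δ * f) (norm_le_zero_iff.1 hx8) h1
  -- `p = δ⁻¹ ∞` is the center of the horoball
  set p := -δ 1 1 / δ 1 0 with hp
  have hp' : δ 1 1 = -p * δ 1 0 := by rw [hp]; field_simp
  have hc0 : 0 < ‖δ 1 0‖ := norm_pos_iff.2 hδ10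
  have nx : ‖(δ * f) 1 0‖ = ‖δ 1 0‖ * ‖ξ - p‖ * ‖g 1 0‖ * a := by
    have : (δ * f) 1 0 = δ 1 0 * (ξ - p) * g 1 0 * a := by rw [ex, hp']; ring
    rw [this, norm_mul, norm_mul, norm_mul, na]
  have ngg : ‖g 0 1‖ = ‖g 1 0‖⁻¹ := by
    have := congrArg norm hgdet
    rw [norm_mul, norm_neg, norm_one] at this
    exact eq_inv_of_mul_eq_one_left this
  have ny : ‖(δ * f) 1 1‖ = ‖δ 1 0‖ * ‖g 1 0‖⁻¹ * a⁻¹ := by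
    rw [ey, norm_mul, norm_mul, norm_inv, na, ngg]
  have hpP : p ∈ approximants Γ ξ K := by
    refine ⟨δ⁻¹, Γ.inv_mem hδ, ?_, ?_⟩
    · rw [smul_infty_eq_coe_iff, inv_apply_one_zero, inv_apply_zero_zero]
      exact ⟨neg_ne_zero.2 hδ10, by rw [hp']; ring⟩
    · rw [inv_apply_one_zero, norm_neg]
      refine le_trans (le_of_eq ?_) hxyK
      rw [nx, ny]
      field_simp
  have hpρ : ρ ≤ ‖ξ - p‖ := by
    by_contra! h
    refine hball ?_ hpP
    rwa [Metric.mem_ball, dist_comm, dist_eq_norm]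
  have h8 := hS (s n) hSn
  rw [nx, ny, ← mul_assoc, ← div_eq_mul_inv, le_div_iff₀ ha0, ← mul_assoc, ← div_eq_mul_inv,
    le_div_iff₀ hτ] at hx8
  have h9 : ‖g 1 0‖ ^ 2 * ρ * a ^ 2 ≤ 8 := by
    have h10 : ‖δ 1 0‖ * (‖g 1 0‖ ^ 2 * ‖ξ - p‖ * a ^ 2) ≤ ‖δ 1 0‖ * 8 := by linarith
    refine le_trans ?_ (le_of_mul_le_mul_left h10 hc0)
    gcongr
  rw [haa] at h9
  linarith

/-! ### The Hurwitz constant -/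

section Discrete

variable {Γ : Subgroup SL(2, ℂ)} [DiscreteTopology Γ]

/-- The endpoint of the axis of a loxodromic element gives an irrational line whose Hurwitz constant
is bounded below by the height of the axis. -/
theorem le_iSup_height (hcusp : IsParabolicFixedPoint Γ (OnePoint.infty : OnePoint ℂ))
    (hnorm : IsCuspNormalized Γ) {γ : SL(2, ℂ)} (hγ : γ ∈ Γ) (hlox : IsLoxodromic γ) :
    1 / (2 * cuspHurwitzConstant Γ) ≤ ⨆ δ ∈ Γ, ENNReal.ofReal (height (δ * γ * δ⁻¹)) := by
  obtain ⟨m, ⟨δ₀, hδ₀, hm⟩, hmax⟩ := exists_isGreatest_height_conj hcusp hγ hlox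
  refine le_trans ?_ (le_iSup₂ δ₀ hδ₀)
  rw [← hm]
  obtain ⟨k, u, hu, rfl⟩ := (isLoxodromic_iff γ).1 hlox
  have hpos : ∀ δ ∈ Γ, 0 < ‖(δ * k) 1 0‖ * ‖(δ * k) 1 1‖ := by
    intro δ hδ
    have hmem : δ * k * diag u * (δ * k)⁻¹ ∈ Γ := by
      rw [← conj_conj_diag]
      exact Γ.mul_mem (Γ.mul_mem hδ hγ) (Γ.inv_mem hδ)
    obtain ⟨h0, h1⟩ := bottom_row_ne_zero_of_loxodromic hcusp hu hmem
    exact mul_pos (norm_pos_iff.2 h0) (norm_pos_iff.2 h1)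
  have hle : ∀ δ ∈ Γ, 1 / (2 * (‖(δ * k) 1 0‖ * ‖(δ * k) 1 1‖)) ≤ m := by
    intro δ hδ
    refine hmax ⟨δ, hδ, ?_⟩
    rw [conj_conj_diag, height_conj_diag _ hu]
  have hm0 : 0 < m := by
    have h1 := hpos 1 Γ.one_mem
    exact lt_of_lt_of_le (by positivity) (hle 1 Γ.one_mem)
  have hκ : ∀ δ ∈ Γ, 1 / (2 * m) ≤ ‖(δ * k) 1 0‖ * ‖(δ * k) 1 1‖ := by
    intro δ hδ
    have h1 := hpos δ hδ
    have h2 := hle δ hδ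
    rw [div_le_iff₀ (by positivity)] at h2 ⊢
    linarith
  have hc := (bottom_row_ne_zero_of_loxodromic hcusp hu hγ).1
  have hkinf : k • (OnePoint.infty : OnePoint ℂ) = ((k 0 0 / k 1 0 : ℂ) : OnePoint ℂ) := by
    rw [smul_infty_eq, if_neg hc]
  have hirr : CuspLine.IsIrrational (Quotient.mk (linkSetoid Γ) (k 0 0 / k 1 0)) := by
    refine ⟨_, rfl, isConicalLimitPoint_of_loxodromic hu hγ hc, ?_⟩
    rw [← hkinf]
    exact not_isParabolicFixedPoint_of_loxodromic hu hγ
  have hK : ENNReal.ofReal (1 / (2 * m)) ≤ cuspHurwitzConstant Γ := by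
    refine le_trans (le_iInf₂ ?_)
      (le_iSup₂ (f := fun (ξ : CuspLine Γ) (_ : ξ.IsIrrational) => ξ.hurwitzConstant) _ hirr)
    rintro K ⟨hK0, hinf⟩
    refine ENNReal.ofReal_le_ofReal ?_
    by_contra! hlt
    refine hinf (CuspLine.finite_of_finite_approximants hcusp hnorm rfl
      (K' := (K + 1 / (2 * m)) / 2) (by linarith)
      (finite_approximants_of_le hcusp hnorm hc hκ (by positivity) (by linarith)))
  calc 1 / (2 * cuspHurwitzConstant Γ) ≤ 1 / (2 * ENNReal.ofReal (1 / (2 * m))) := by gcongr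
    _ = ENNReal.ofReal m := by
      rw [← ENNReal.ofReal_ofNat 2, ← ENNReal.ofReal_mul zero_le_two, one_div (ENNReal.ofReal _),
        ← ENNReal.ofReal_inv_of_pos (by positivity)]
      congr 1
      field_simp

/-- A constant `K` strictly below the Hurwitz constant of an irrational line has only finitely many
approximants, so the closing argument applies to it. -/
theorem iInf_iSup_height_le (hcusp : IsParabolicFixedPoint Γ (OnePoint.infty : OnePoint ℂ))
    (hnorm : IsCuspNormalized Γ) :
    ⨅ γ ∈ {γ : SL(2, ℂ) | γ ∈ Γ ∧ IsLoxodromic γ},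
        ⨆ δ ∈ Γ, ENNReal.ofReal (height (δ * γ * δ⁻¹)) ≤ 1 / (2 * cuspHurwitzConstant Γ) := by
  by_contra! hlt
  obtain ⟨y, hy1, hy2⟩ := exists_between hlt
  have hytop : y ≠ ⊤ := hy2.ne_top
  have hy0 : 0 < y.toReal := ENNReal.toReal_pos (bot_lt_of_lt hy1).ne' hytop
  set κ := 1 / (2 * y.toReal) with hκ
  have hκ0 : 0 < κ := by positivity
  have hκK : ENNReal.ofReal κ < cuspHurwitzConstant Γ := by
    rw [one_div, ENNReal.inv_lt_iff_inv_lt, ← ENNReal.ofReal_toReal hytop,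
      ← ENNReal.ofReal_inv_of_pos hy0] at hy1
    have h1 : ENNReal.ofReal y.toReal⁻¹ = 2 * ENNReal.ofReal κ := by
      rw [← ENNReal.ofReal_ofNat 2, ← ENNReal.ofReal_mul zero_le_two, hκ]
      congr 1
      field_simp
    rw [h1] at hy1
    exact lt_of_mul_lt_mul_left' hy1
  obtain ⟨ξ, hξ⟩ := lt_iSup_iff.1 hκK
  obtain ⟨⟨z, hz, hcon, hpar⟩, hξ⟩ := lt_iSup_iff.1 hξ
  obtain ⟨K', hK1, hK2⟩ := exists_between hξ
  have hKtop : K' ≠ ⊤ := hK2.ne_top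
  have hκK' : κ < K'.toReal := (ENNReal.ofReal_lt_iff_lt_toReal hκ0.le hKtop).1 hK1
  have hfin : {r : CuspLine Γ | r.IsRational ∧
      ξ.ldist r ≤ K'.toReal * Real.exp (-r.depth)}.Finite := by
    by_contra hinf
    refine hK2.not_ge ?_
    rw [← ENNReal.ofReal_toReal hKtop]
    exact iInf₂_le K'.toReal ⟨hκ0.trans hκK', hinf⟩
  obtain ⟨k, u, hu, hmem, hle⟩ := exists_loxodromic_of_finite_approximants hcusp hcon hpar hκ0 hκK'
    (CuspLine.finite_approximants hcusp hnorm hz hfin)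
  refine hy2.not_ge (iInf₂_le_of_le (k * diag u * k⁻¹)
    ⟨hmem, (isLoxodromic_iff _).2 ⟨k, u, hu, rfl⟩⟩ (iSup₂_le fun δ hδ => ?_))
  rw [conj_conj_diag, height_conj_diag _ hu]
  refine ENNReal.ofReal_le_of_le_toReal ?_
  have h1 := hle δ hδ
  have h2 : 1 / (2 * κ) = y.toReal := by
    rw [hκ]
    field_simp
  rw [← h2]
  gcongr

end Discrete

/-- The last equality is in `[0, ∞]`. -/
theorem mainTheorem4 (Γ : Subgroup SL(2, ℂ)) [DiscreteTopology Γ]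
    (hgf : IsGeometricallyFinite Γ) (hne : IsNonElementary Γ)
    (hcusp : IsParabolicFixedPoint Γ (OnePoint.infty : OnePoint ℂ)) (hnorm : IsCuspNormalized Γ) :
    (∀ γ ∈ Γ, IsLoxodromic γ →
      IsGreatest {s : ℝ | ∃ x ∈ loxodromicAxis γ, x.t = s} (height γ)) ∧
    (∀ γ ∈ Γ, IsLoxodromic γ →
      ∃ m : ℝ, IsGreatest {s : ℝ | ∃ δ ∈ Γ, s = height (δ * γ * δ⁻¹)} m) ∧
    1 / (2 * cuspHurwitzConstant Γ) =
      ⨅ γ ∈ {γ : SL(2, ℂ) | γ ∈ Γ ∧ IsLoxodromic γ},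
        ⨆ δ ∈ Γ, ENNReal.ofReal (height (δ * γ * δ⁻¹)) := by
  refine ⟨fun γ hγ hlox => isGreatest_height hcusp hγ hlox,
    fun γ hγ hlox => exists_isGreatest_height_conj hcusp hγ hlox, le_antisymm ?_ ?_⟩
  · exact le_iInf₂ fun γ h => le_iSup_height hcusp hnorm h.1 h.2
  · exact iInf_iSup_height_le hcusp hnorm
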